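/- **Setting.** Fix $T>0$, $d\in\mathbb N$ and a probability measure $\mathbb P_0$ on the space $D^d$ of càdlàg functions $[0,T]\to\mathbb R^d$ (with the $\sigma$-algebra generated by the coordinate maps). Let $D_\uparrow$ be the space of nondecreasing càdlàg functions $A:[0,T]\to\mathbb R$ with $A_0\ge 0$, and let $(L,A)$ be the coordinate pair on $D^d\times D_\uparrow$. Put $\mathcal F^L_t=\sigma(L_s;s\le t)$, $\mathcal F^A_t=\sigma(A_s;s\le t)$, $\mathcal F^L_{t+}=\bigcap_{s>t}\mathcal F^L_s$ for $t<T$, and $\mathcal F^L_{T+}=\mathcal F^L_T$. Let $\mathcal A$ be the set of all probability measures $\mathbb P$ on $D^d\times D_\uparrow$ under which $L$ has law $\mathbb P_0$ and, for each $t\in[0,T]$, $\mathcal F^A_t$ and $\mathcal F^L_T$ are conditionally independent given $\mathcal F^L_{t+}$. Let $f:[0,T]\to[0,\infty)$ be continuous and let $g,h:\mathbb R^d\times[0,\infty)\to[0,\infty)$ be measurable, with $g(l,\cdot)$ and $h(l,\cdot)$ convex and continuously differentiable on $[0,\infty)$ for each $l$; write $g_a,h_a$ for the derivatives in the second variable (one-sided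 at $0$). A *solution of the monotone-follower problem* is a $\hat{\mathbb P}\in\mathcal A$ with $J(\hat{\mathbb P})<\infty$ and $J(\hat{\mathbb P})=\inf_{\mathbb P\in\mathcal A}J(\mathbb P)$, where $$J(\mathbb P)=\mathbb E^{\mathbb P}\Big[\int_{[0,T]}f(t)\,dA_t+\int_0^Th(L_t,A_t)\,dt+g(L_T,A_T)\Big],\qquad \int_{[0,T]}f\,dA:=f(0)A_0+\int_{(0,T]}f\,dA .$$ Let $\tau_A=\inf\{t\in[0,T]:A_t>0\}$ (with $\inf\emptyset=+\infty$) and $$Z=\Big(f(\tau_A)+g_a(L_T,0)+\int_{\tau_A}^Th_a(L_t,0)\,dt\Big)1_{\{\tau_A<\infty\}} .$$ Let $\mathcal A_S$ be the set of all $\mathbb P\in\mathcal A$ under which $Z$ is well defined a.s. and integrable, and put $K(\mathbb P)=\mathbb E^{\mathbb P}[Z]$ for $\mathbb P\in\mathcal A_S$. A *solution of the (randomized) optimal-stopping problem* is a $\hat{\mathbb P}\in\mathcal A_S$ with $K(\hat{\mathbb P})\le K(\mathbb P)$ for all $\mathbb P\in\mathcal A_S$. **Theorem.** Suppose that there are Borel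 functions $\Phi_g,\Phi_h:\mathbb R^d\to[0,\infty)$ and a constant $M\ge0$ such that $\mathbb E^{\mathbb P_0}\big[\int_0^T\Phi_h(L_t)\,dt+\Phi_g(L_T)\big]<\infty$ and $|\varphi_a(l,a)|\le\Phi_\varphi(l)+M\varphi(l,a)$ for $\varphi\in\{g,h\}$, $l\in\mathbb R^d$, $a\ge0$. Let $\hat{\mathbb P}$ be a solution of the monotone-follower problem. Then: 1. $\int_0^T|h_a(L_t,0)|\,dt<\infty$ $\mathbb P_0$-a.s., and for every $\mathbb P\in\mathcal A$ the variable $Z$ is $\mathbb P$-measurable with $\mathbb E^{\mathbb P}[Z^+]<\infty$, so that $\mathbb E^{\mathbb P}[Z]=\mathbb E^{\mathbb P}[Z^+]-\mathbb E^{\mathbb P}[Z^-]\in[-\infty,\infty)$ is well defined; 2. $\mathbb E^{\hat{\mathbb P}}[Z]\le\mathbb E^{\mathbb P}[Z]$ for every $\mathbb P\in\mathcal A$, with expectations in $[-\infty,\infty)$; 3. consequently, if $\hat{\mathbb P}\in\mathcal A_S$ (that is, if $\mathbb E^{\hat{\mathbb P}}[Z]>-\infty$), then $\hat{\mathbb P}$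 is a solution of the optimal-stopping problem. -/

import Mathlib

open MeasureTheory Set Filter Topology
open scoped ENNReal

noncomputable section

namespace MonotoneFollower

/-- A function on the time interval `[0,T]` is càdlàg: right-continuous with left limits. -/
def IsCadlag {T : ℝ} {E : Type*} [TopologicalSpace E] (x : Icc (0 : ℝ) T → E) : Prop :=
  ∀ t, ContinuousWithinAt x (Ici t) t ∧ ∃ l, Tendsto x (𝓝[<] t) (𝓝 l)

/-- The path space of all càdlàg functions `[0,T] → E`. -/
structure CadlagPath (T : ℝ) (E : Type*) [TopologicalSpace E] where
  toFun : Icc (0 : ℝ) T → E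
  cadlag : IsCadlag toFun

/-- The path space of nondecreasing càdlàg functions `A : [0,T] → ℝ` with `A 0 ≥ 0`. -/
structure IncreasingPath (T : ℝ) extends CadlagPath T ℝ where
  mono : Monotone toFun
  nonneg : ∀ t, 0 ≤ toFun t

/-- The `σ`-algebra generated by the coordinate maps. -/
instance {T : ℝ} {E : Type*} [TopologicalSpace E] [MeasurableSpace E] :
    MeasurableSpace (CadlagPath T E) :=
  MeasurableSpace.comap CadlagPath.toFun MeasurableSpace.pi

/-- The `σ`-algebra generated by the coordinate maps. -/
instance {T : ℝ} : MeasurableSpace (IncreasingPath T) :=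
  MeasurableSpace.comap (fun A => A.toFun) MeasurableSpace.pi

section Eval

variable {T : ℝ} [hT : Fact (0 < T)]

/-- The value of a path at a time `t`. Only the values for `t ∈ [0,T]` are meaningful
(the path is frozen outside of `[0,T]`). -/
def CadlagPath.eval {E : Type*} [TopologicalSpace E] (x : CadlagPath T E) (t : ℝ) : E :=
  x.toFun (projIcc 0 T hT.out.le t)

instance {E : Type*} [TopologicalSpace E] : CoeFun (CadlagPath T E) (fun _ => ℝ → E) :=
  ⟨CadlagPath.eval⟩

/-- The value of a nondecreasing path at a time `t ∈ [0,T]`. -/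
def IncreasingPath.eval (A : IncreasingPath T) (t : ℝ) : ℝ :=
  A.toFun (projIcc 0 T hT.out.le t)

instance : CoeFun (IncreasingPath T) (fun _ => ℝ → ℝ) := ⟨IncreasingPath.eval⟩

/-- The path `A`, taken to be `0` on `(-∞,0)`, as a Stieltjes function. Its Stieltjes measure
has an atom of mass `A 0` at time `0`. -/
def IncreasingPath.stieltjes (A : IncreasingPath T) : StieltjesFunction ℝ where
  toFun t := if t < 0 then 0 else A t
  mono' s t hst := by
    dsimp only
    split_ifs with hs ht ht
    · exact le_rfl
    · exact A.nonneg _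
    · exact absurd (hst.trans_lt ht) hs
    · exact A.mono (monotone_projIcc _ hst)
  right_continuous' t := by
    by_cases ht : t < 0
    · have h : (fun s : ℝ => if s < 0 then (0 : ℝ) else A s) =ᶠ[𝓝 t] fun _ => 0 := by
        filter_upwards [Iio_mem_nhds ht] with s hs
        exact if_pos hs
      exact (continuousAt_const.congr h.symm).continuousWithinAt
    · have h1 : ContinuousWithinAt (fun s : ℝ => A s) (Ici t) t :=
        ContinuousWithinAt.comp (t := Ici (projIcc 0 T hT.out.le t))
          (A.cadlag (projIcc 0 T hT.out.le t)).1 continuous_projIcc.continuousWithinAt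
          (fun s hs => mem_Ici.2 (monotone_projIcc _ (mem_Ici.1 hs)))
      refine h1.congr (fun s hs => if_neg ?_) (if_neg ht)
      exact not_lt.2 ((not_lt.1 ht).trans hs)

/-- The first time `A` becomes positive, `inf {t ∈ [0,T] : A t > 0}`, with `inf ∅ = +∞`. -/
def firstPositive (A : IncreasingPath T) : EReal :=
  sInf ((fun t : ℝ => (t : EReal)) '' {t | t ∈ Icc 0 T ∧ 0 < A t})

end Eval

/-- The sample space of pairs `(L,A)`: a càdlàg target `L` in `ℝ^d`, and a nondecreasing
one-dimensional càdlàg follower `A`. -/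
abbrev PathPair (d : ℕ) (T : ℝ) : Type :=
  CadlagPath T (EuclideanSpace ℝ (Fin d)) × IncreasingPath T

/-- The raw `σ`-algebra `σ(L_r ; r ∈ [0,T], r ≤ s)`. -/
@[reducible] def sigmaL (d : ℕ) (T : ℝ) (s : ℝ) : MeasurableSpace (PathPair d T) :=
  ⨆ (r : Icc (0 : ℝ) T) (_ : (r : ℝ) ≤ s),
    MeasurableSpace.comap (fun ω : PathPair d T => ω.1.toFun r) inferInstance

/-- The raw `σ`-algebra `σ(A_r ; r ∈ [0,T], r ≤ s)`. -/
@[reducible] def sigmaA (d : ℕ) (T : ℝ) (s : ℝ) : MeasurableSpace (PathPair d T) :=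
  ⨆ (r : Icc (0 : ℝ) T) (_ : (r : ℝ) ≤ s),
    MeasurableSpace.comap (fun ω : PathPair d T => ω.2.toFun r) inferInstance

/-- The right-continuous enlargement `⋂_{s > t} σ(L_r ; r ∈ [0,T], r ≤ s)`. At `t = T` this is
`σ(L_r ; r ∈ [0,T])`. -/
@[reducible] def sigmaLPlus (d : ℕ) (T : ℝ) (t : ℝ) : MeasurableSpace (PathPair d T) :=
  ⨅ (s : ℝ) (_ : t < s), sigmaL d T s

/-- The `σ`-algebras `m₁` and `m₂` are `P`-independent conditionally on `m`. -/
def CondIndepGiven {Ω : Type*} (m m₁ m₂ : MeasurableSpace Ω) {mΩ : MeasurableSpace Ω}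
    (P : Measure[mΩ] Ω) : Prop :=
  ∀ S₁ S₂ : Set Ω, MeasurableSet[m₁] S₁ → MeasurableSet[m₂] S₂ →
    P[(S₁ ∩ S₂).indicator (fun _ => (1 : ℝ)) | m] =ᵐ[P]
      P[S₁.indicator (fun _ => (1 : ℝ)) | m] * P[S₂.indicator (fun _ => (1 : ℝ)) | m]

/-- Admissible controls: the `L`-marginal is `P₀`, and for each `t` the past of `A` up to `t` is
independent of the whole of `L`, conditionally on the right-continuous past of `L` at `t`. -/
structure Admissible {d : ℕ} {T : ℝ} (P₀ : Measure (CadlagPath T (EuclideanSpace ℝ (Fin d))))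
    (P : Measure (PathPair d T)) : Prop where
  marginal : P.map Prod.fst = P₀
  condIndep : ∀ t ∈ Icc (0 : ℝ) T,
    CondIndepGiven (sigmaLPlus d T t) (sigmaA d T t) (sigmaL d T T) P

/-- The ingredients `f`, `g`, `h` of a cost functional, for a one-dimensional control. The
functions `f` and `g l`, `h l` matter only on `[0,T]` and on `[0,∞)`, respectively. -/
structure CostIngredients (d : ℕ) (T : ℝ) where
  f : ℝ → ℝ
  g : EuclideanSpace ℝ (Fin d) → ℝ → ℝ
  h : EuclideanSpace ℝ (Fin d) → ℝ → ℝ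
  f_nonneg : ∀ t ∈ Icc 0 T, 0 ≤ f t
  f_cont : ContinuousOn f (Icc 0 T)
  g_nonneg : ∀ l, ∀ a, 0 ≤ a → 0 ≤ g l a
  h_nonneg : ∀ l, ∀ a, 0 ≤ a → 0 ≤ h l a
  g_meas : Measurable fun p : EuclideanSpace ℝ (Fin d) × Ici (0 : ℝ) => g p.1 p.2
  h_meas : Measurable fun p : EuclideanSpace ℝ (Fin d) × Ici (0 : ℝ) => h p.1 p.2
  g_convex : ∀ l, ConvexOn ℝ (Ici 0) (g l)
  h_convex : ∀ l, ConvexOn ℝ (Ici 0) (h l)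

/-- The derivative `φ_a(l,a)` of `φ(l,·)` on `[0,∞)` (one-sided at `a = 0`). -/
def derivA {E : Type*} (φ : E → ℝ → ℝ) (l : E) (a : ℝ) : ℝ :=
  derivWithin (φ l) (Ici 0) a

section Problems

variable {d : ℕ} {T : ℝ} [hT : Fact (0 < T)]

/-- The cost `C(L,A) = ∫_{[0,T]} f dA + ∫_0^T h(L_t,A_t) dt + g(L_T,A_T) ∈ [0,∞]`, where the
first integral counts the initial jump as `f(0) A_0`. -/
def CostIngredients.cost (c : CostIngredients d T) (ω : PathPair d T) : ℝ≥0∞ :=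
  (∫⁻ t in Icc 0 T, ENNReal.ofReal (c.f t) ∂ω.2.stieltjes.measure)
    + (∫⁻ t in Icc 0 T, ENNReal.ofReal (c.h (ω.1 t) (ω.2 t)))
    + ENNReal.ofReal (c.g (ω.1 T) (ω.2 T))

/-- The expected cost `J(P)`. -/
def CostIngredients.J (c : CostIngredients d T) (P : Measure (PathPair d T)) : ℝ≥0∞ :=
  ∫⁻ ω, c.cost ω ∂P

/-- (Weak) solutions of the monotone-follower problem: admissible controls of finite cost
whose cost is the value of the problem. -/
def IsFollowerSolution (P₀ : Measure (CadlagPath T (EuclideanSpace ℝ (Fin d))))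
    (c : CostIngredients d T) (P : Measure (PathPair d T)) : Prop :=
  Admissible P₀ P ∧ c.J P < ∞ ∧
    c.J P = ⨅ (P' : Measure (PathPair d T)) (_ : Admissible P₀ P'), c.J P'

/-- The random variable
`(f(τ_A) + g_a(L_T,0) + ∫_{τ_A}^T h_a(L_t,0) dt) 1_{τ_A < ∞}`
whose expectation is minimized in the optimal-stopping problem. -/
def CostIngredients.stoppingCost (c : CostIngredients d T) (ω : PathPair d T) : ℝ :=
  open scoped Classical in
  if firstPositive ω.2 = ⊤ then 0
  else c.f (firstPositive ω.2).toReal + derivA c.g (ω.1 T) 0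
    + ∫ t in (firstPositive ω.2).toReal..T, derivA c.h (ω.1 t) 0

/-- The class `𝒜_S` of admissible `P` under which the stopping cost is well defined and
integrable. -/
def StoppingAdmissible (P₀ : Measure (CadlagPath T (EuclideanSpace ℝ (Fin d))))
    (c : CostIngredients d T) (P : Measure (PathPair d T)) : Prop :=
  Admissible P₀ P ∧
    (∀ᵐ ω ∂P, firstPositive ω.2 ≠ ⊤ → IntervalIntegrable (fun t => derivA c.h (ω.1 t) 0)
      volume (firstPositive ω.2).toReal T) ∧
    Integrable c.stoppingCost P

/-- The objective `K(P)` of the optimal-stopping problem, for `P ∈ 𝒜_S`. -/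
def CostIngredients.K (c : CostIngredients d T) (P : Measure (PathPair d T)) : ℝ :=
  ∫ ω, c.stoppingCost ω ∂P

/-- Solutions of the optimal-stopping problem. -/
def IsStoppingSolution (P₀ : Measure (CadlagPath T (EuclideanSpace ℝ (Fin d))))
    (c : CostIngredients d T) (P : Measure (PathPair d T)) : Prop :=
  StoppingAdmissible P₀ c P ∧ ∀ P', StoppingAdmissible P₀ c P' → c.K P ≤ c.K P'

/-- The expectation of the stopping cost in the extended sense, `E[Z⁺] - E[Z⁻]`. It is
meaningful, with values in `[-∞,∞)`, when `Z` is measurable and `E[Z⁺] < ∞`. -/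
def CostIngredients.extendedK (c : CostIngredients d T) (P : Measure (PathPair d T)) : EReal :=
  ((∫⁻ ω, ENNReal.ofReal (c.stoppingCost ω) ∂P : ℝ≥0∞) : EReal)
    - ((∫⁻ ω, ENNReal.ofReal (-c.stoppingCost ω) ∂P : ℝ≥0∞) : EReal)

end Problems

end MonotoneFollower

end

noncomputable section

namespace MonotoneFollower

open scoped NNReal

section Paths

variable {T : ℝ}

theorem measurable_toFun {E : Type*} [TopologicalSpace E] [MeasurableSpace E]
    (r : Icc (0 : ℝ) T) : Measurable fun x : CadlagPath T E => x.toFun r :=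
  (measurable_pi_apply r).comp (comap_measurable _)

theorem measurable_increasing_toFun (r : Icc (0 : ℝ) T) :
    Measurable fun A : IncreasingPath T => A.toFun r :=
  (measurable_pi_apply r).comp (comap_measurable (fun A : IncreasingPath T => A.toFun))

theorem measurable_to_increasing {α : Type*} [MeasurableSpace α] {F : α → IncreasingPath T}
    (hF : ∀ r, Measurable fun a => (F a).toFun r) : Measurable F := by
  rw [measurable_comap_iff]
  exact measurable_pi_iff.2 hF

theorem measurable_toCadlagPath :
    Measurable fun A : IncreasingPath T => A.toCadlagPath := by
  rw [measurable_comap_iff]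
  exact measurable_pi_iff.2 measurable_increasing_toFun

/-- A nonnegative nondecreasing right-continuous function is a nondecreasing path. -/
def IncreasingPath.ofRightContinuous (x : Icc (0 : ℝ) T → ℝ) (hm : Monotone x)
    (h0 : ∀ t, 0 ≤ x t) (hr : ∀ t, ContinuousWithinAt x (Ici t) t) : IncreasingPath T where
  toFun := x
  cadlag t := ⟨hr t, _, hm.tendsto_nhdsLT t⟩
  mono := hm
  nonneg := h0

theorem continuousWithinAt_step (s c : ℝ) (t : Icc (0 : ℝ) T) :
    ContinuousWithinAt (fun t : Icc (0 : ℝ) T => if s ≤ (t : ℝ) then c else 0) (Ici t) t := by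
  by_cases h : s ≤ (t : ℝ)
  · refine (continuousWithinAt_const (b := c)).congr (fun u hu => if_pos ?_) (if_pos h)
    exact h.trans (Subtype.coe_le_coe.2 hu)
  · have : (fun t : Icc (0 : ℝ) T => if s ≤ (t : ℝ) then c else 0) =ᶠ[𝓝 t] fun _ => 0 := by
      have h1 : ∀ᶠ u : Icc (0 : ℝ) T in 𝓝 t, (u : ℝ) < s :=
        continuous_subtype_val.continuousAt.eventually (Iio_mem_nhds (not_le.1 h))
      filter_upwards [h1] with u hu
      exact if_neg (not_le.2 hu)
    exact (continuousAt_const.congr this.symm).continuousWithinAt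

/-- The bottom part `A ∧ ε` of a nondecreasing path. -/
def IncreasingPath.bottom (A : IncreasingPath T) (ε : ℝ≥0) : IncreasingPath T :=
  .ofRightContinuous (fun t => min (A.toFun t) ε) (fun _ _ h => min_le_min_right _ (A.mono h))
    (fun t => le_min (A.nonneg t) ε.2) (fun t => (A.cadlag t).1.min continuousWithinAt_const)

/-- The path `(A - ε)⁺ + ε 1_{s ≤ t}`: the bottom part of `A` is replaced by a jump at time `s`. -/
def IncreasingPath.replaceBottom (A : IncreasingPath T) (ε : ℝ≥0) (s : ℝ) : IncreasingPath T :=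
  .ofRightContinuous (fun t => max (A.toFun t - ε) 0 + if s ≤ (t : ℝ) then (ε : ℝ) else 0)
    (fun t u h => by
      refine add_le_add (max_le_max_right _ (sub_le_sub_right (A.mono h) _)) ?_
      have h' : (t : ℝ) ≤ u := h
      split_ifs with h1 h2 h2
      · exact le_rfl
      · exact absurd (h1.trans h') h2
      · exact ε.2
      · exact le_rfl)
    (fun t => add_nonneg (le_max_right _ _) (by split_ifs <;> simp))
    (fun t => (((A.cadlag t).1.sub continuousWithinAt_const).max continuousWithinAt_const).add
      (continuousWithinAt_step s ε t))

theorem measurable_bottom (ε : ℝ≥0) : Measurable fun A : IncreasingPath T => A.bottom ε :=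
  measurable_to_increasing fun r => (measurable_increasing_toFun r).min measurable_const

theorem measurable_replaceBottom (ε : ℝ≥0) :
    Measurable fun p : IncreasingPath T × ℝ => p.1.replaceBottom ε p.2 := by
  refine measurable_to_increasing fun r => ?_
  refine ((((measurable_increasing_toFun r).comp measurable_fst).sub_const _).max
    measurable_const).add ?_
  exact Measurable.ite (measurableSet_le measurable_snd measurable_const) measurable_const
    measurable_const

variable [hT : Fact (0 < T)]


theorem IncreasingPath.eval_mono (A : IncreasingPath T) : Monotone A.eval :=
  fun _ _ h => A.mono (monotone_projIcc _ h)

theorem IncreasingPath.eval_nonneg (A : IncreasingPath T) (t : ℝ) : 0 ≤ A t := A.nonneg _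

theorem IncreasingPath.eval_le (A : IncreasingPath T) (t : ℝ) : A t ≤ A T :=
  A.mono (by rw [projIcc_right]; exact (projIcc 0 T hT.out.le t).2.2)

theorem CadlagPath.continuousWithinAt_eval {E : Type*} [TopologicalSpace E]
    (x : CadlagPath T E) (t : ℝ) : ContinuousWithinAt x.eval (Ici t) t :=
  ContinuousWithinAt.comp (t := Ici (projIcc 0 T hT.out.le t))
    (x.cadlag (projIcc 0 T hT.out.le t)).1 continuous_projIcc.continuousWithinAt
    (fun _ hs => mem_Ici.2 (monotone_projIcc _ (mem_Ici.1 hs)))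

theorem measurable_eval {E : Type*} [TopologicalSpace E] [MeasurableSpace E] (t : ℝ) :
    Measurable fun x : CadlagPath T E => x t := measurable_toFun _

theorem measurable_increasing_eval (t : ℝ) :
    Measurable fun A : IncreasingPath T => A t := measurable_increasing_toFun _

theorem tendsto_floor_add_one_div (t : ℝ) :
    Tendsto (fun n : ℕ => ((⌊((n : ℝ) + 1) * t⌋ : ℝ) + 1) / ((n : ℝ) + 1)) atTop (𝓝[≥] t) := by
  have hpos : ∀ n : ℕ, (0 : ℝ) < (n : ℝ) + 1 := fun n => by positivity
  refine tendsto_nhdsWithin_iff.2 ⟨?_, Eventually.of_forall fun n => ?_⟩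
  · have h1 : Tendsto (fun n : ℕ => t + 1 / ((n : ℝ) + 1)) atTop (𝓝 t) := by
      simpa using tendsto_const_nhds.add (tendsto_one_div_add_atTop_nhds_zero_nat (𝕜 := ℝ))
    refine tendsto_of_tendsto_of_tendsto_of_le_of_le tendsto_const_nhds h1 (fun n => ?_)
      (fun n => ?_)
    · rw [le_div_iff₀ (hpos n)]
      nlinarith [Int.lt_floor_add_one (((n : ℝ) + 1) * t)]
    · rw [div_le_iff₀ (hpos n), add_mul t, one_div, inv_mul_cancel₀ (hpos n).ne']
      nlinarith [Int.floor_le (((n : ℝ) + 1) * t)]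
  · rw [mem_Ici, le_div_iff₀ (hpos n)]
    nlinarith [Int.lt_floor_add_one (((n : ℝ) + 1) * t)]

/-- Càdlàg paths are jointly measurable. -/
theorem measurable_eval_uncurry {E : Type*} [TopologicalSpace E]
    [TopologicalSpace.PseudoMetrizableSpace E]
    [MeasurableSpace E] [BorelSpace E] :
    Measurable fun p : CadlagPath T E × ℝ => p.1 p.2 := by
  refine measurable_of_tendsto_metrizable (f := fun (n : ℕ) (p : CadlagPath T E × ℝ) =>
    p.1 (((⌊((n : ℝ) + 1) * p.2⌋ : ℝ) + 1) / ((n : ℝ) + 1))) (fun n => ?_) ?_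
  · have h1 : Measurable fun p : CadlagPath T E × ℤ => p.1 (((p.2 : ℝ) + 1) / ((n : ℝ) + 1)) :=
      measurable_from_prod_countable_left fun k => measurable_eval (((k : ℝ) + 1) / ((n : ℝ) + 1))
    have h2 : Measurable fun p : CadlagPath T E × ℝ => (p.1, ⌊((n : ℝ) + 1) * p.2⌋) :=
      measurable_fst.prodMk (Int.measurable_floor.comp (measurable_snd.const_mul _))
    exact h1.comp h2
  · rw [tendsto_pi_nhds]
    intro p
    exact (p.1.continuousWithinAt_eval p.2).tendsto.comp (tendsto_floor_add_one_div p.2)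

theorem measurable_increasing_eval_uncurry :
    Measurable fun p : IncreasingPath T × ℝ => p.1 p.2 :=
  measurable_eval_uncurry.comp (measurable_toCadlagPath.prodMap measurable_id)

theorem IncreasingPath.bottom_eval (A : IncreasingPath T) (ε : ℝ≥0) (t : ℝ) :
    A.bottom ε t = min (A t) ε := rfl

theorem IncreasingPath.replaceBottom_eval (A : IncreasingPath T) (ε : ℝ≥0) (s : ℝ) {t : ℝ}
    (ht : t ∈ Icc 0 T) :
    A.replaceBottom ε s t = max (A t - ε) 0 + if s ≤ t then (ε : ℝ) else 0 := by
  simp [IncreasingPath.eval, IncreasingPath.replaceBottom, IncreasingPath.ofRightContinuous,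
    projIcc_of_mem _ ht]

/-! ### The Stieltjes measure of a nondecreasing path -/

theorem IncreasingPath.stieltjes_apply (A : IncreasingPath T) (t : ℝ) :
    A.stieltjes t = if t < 0 then 0 else A t := rfl

theorem IncreasingPath.tendsto_stieltjes_atBot (A : IncreasingPath T) :
    Tendsto A.stieltjes atBot (𝓝 0) := by
  refine tendsto_const_nhds.congr' ?_
  filter_upwards [Iio_mem_atBot (0 : ℝ)] with t ht
  exact (if_pos ht).symm

theorem IncreasingPath.stieltjes_Iic (A : IncreasingPath T) (t : ℝ) :
    A.stieltjes.measure (Iic t) = ENNReal.ofReal (if t < 0 then 0 else A t) := by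
  rw [StieltjesFunction.measure_Iic _ A.tendsto_stieltjes_atBot, sub_zero]
  rfl

theorem IncreasingPath.eval_of_ge (A : IncreasingPath T) {t : ℝ} (ht : T ≤ t) : A t = A T := by
  simp only [IncreasingPath.eval, projIcc_of_right_le _ ht, projIcc_right]

theorem IncreasingPath.stieltjes_univ (A : IncreasingPath T) :
    A.stieltjes.measure univ = ENNReal.ofReal (A T) := by
  have h : Tendsto A.stieltjes atTop (𝓝 (A T)) := by
    refine tendsto_const_nhds.congr' ?_
    filter_upwards [Ici_mem_atTop T] with t ht
    rw [A.stieltjes_apply, if_neg (not_lt.2 (hT.out.le.trans ht)), A.eval_of_ge ht]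
  rw [StieltjesFunction.measure_univ _ A.tendsto_stieltjes_atBot h, sub_zero]

instance (A : IncreasingPath T) : IsFiniteMeasure A.stieltjes.measure :=
  ⟨by rw [A.stieltjes_univ]; exact ENNReal.ofReal_lt_top⟩

theorem measurable_stieltjes :
    Measurable fun A : IncreasingPath T => A.stieltjes.measure := by
  refine Measurable.measure_of_isPiSystem (borel_eq_generateFrom_Iic ℝ ▸ BorelSpace.measurable_eq)
    isPiSystem_Iic ?_ ?_
  · rintro _ ⟨t, rfl⟩
    simp only [IncreasingPath.stieltjes_Iic]
    split_ifs
    · exact measurable_const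
    · exact (measurable_increasing_eval t).ennreal_ofReal
  · simp only [IncreasingPath.stieltjes_univ]
    exact (measurable_increasing_eval T).ennreal_ofReal

theorem IncreasingPath.stieltjes_replaceBottom (A : IncreasingPath T) (ε : ℝ≥0) {s : ℝ}
    (hs : s ∈ Icc 0 T) :
    (A.replaceBottom ε s).stieltjes.measure + (A.bottom ε).stieltjes.measure
      = A.stieltjes.measure + (ε : ℝ≥0∞) • Measure.dirac s := by
  have : IsFiniteMeasure ((ε : ℝ≥0∞) • Measure.dirac s) :=
    ⟨by simp⟩
  refine Measure.ext_of_Iic _ _ fun t => ?_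
  simp only [Measure.coe_add, Pi.add_apply, stieltjes_Iic, Measure.smul_apply,
    Measure.dirac_apply' _ measurableSet_Iic, smul_eq_mul]
  by_cases ht : t < 0
  · have : s ∉ Iic t := fun h => absurd (hs.1.trans h) (not_le.2 ht)
    simp [ht, this]
  · simp only [if_neg ht]
    have hind : ((ε : ℝ≥0∞) * (Iic t).indicator 1 s)
        = ENNReal.ofReal (if s ≤ t then (ε : ℝ) else 0) := by
      by_cases h : s ≤ t <;> simp [h, indicator]
    rw [hind, ← ENNReal.ofReal_add (eval_nonneg _ _) (eval_nonneg _ _),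
      ← ENNReal.ofReal_add (eval_nonneg _ _) (by split_ifs <;> simp)]
    congr 1
    rw [bottom_eval]
    rcases le_or_gt t T with h | h
    · rw [replaceBottom_eval _ _ _ ⟨not_lt.1 ht, h⟩]
      rcases le_total (A t) ε with h' | h'
      · rw [min_eq_left h', max_eq_right (by linarith)]; ring
      · rw [min_eq_right h', max_eq_left (by linarith)]; ring
    · rw [eval_of_ge _ h.le, replaceBottom_eval _ _ _ ⟨hT.out.le, le_rfl⟩, A.eval_of_ge h.le,
        if_pos hs.2, if_pos (hs.2.trans h.le)]
      rcases le_total (A T) ε with h' | h'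
      · rw [min_eq_left h', max_eq_right (by linarith)]; ring
      · rw [min_eq_right h', max_eq_left (by linarith)]; ring

theorem IncreasingPath.stieltjes_replaceBottom_of_gt (A : IncreasingPath T) (ε : ℝ≥0) {s : ℝ}
    (hs : T < s) :
    (A.replaceBottom ε s).stieltjes.measure + (A.bottom ε).stieltjes.measure
      = A.stieltjes.measure := by
  refine Measure.ext_of_Iic _ _ fun t => ?_
  simp only [Measure.coe_add, Pi.add_apply, stieltjes_Iic]
  by_cases ht : t < 0
  · simp [ht]
  · simp only [if_neg ht]
    rw [← ENNReal.ofReal_add (eval_nonneg _ _) (eval_nonneg _ _)]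
    congr 1
    rw [bottom_eval]
    rcases le_or_gt t T with h | h
    · rw [replaceBottom_eval _ _ _ ⟨not_lt.1 ht, h⟩, if_neg (not_le.2 (h.trans_lt hs))]
      rcases le_total (A t) ε with h' | h'
      · rw [min_eq_left h', max_eq_right (by linarith)]; ring
      · rw [min_eq_right h', max_eq_left (by linarith)]; ring
    · rw [eval_of_ge _ h.le, replaceBottom_eval _ _ _ ⟨hT.out.le, le_rfl⟩, A.eval_of_ge h.le,
        if_neg (not_le.2 hs)]
      rcases le_total (A T) ε with h' | h'
      · rw [min_eq_left h', max_eq_right (by linarith)]; ring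
      · rw [min_eq_right h', max_eq_left (by linarith)]; ring

/-! ### The first time at which a nondecreasing path is positive -/

/-- The first time `A` becomes positive, as a real number, with the value `T + 1` if `A` vanishes
on `[0,T]`. -/
def startTime (A : IncreasingPath T) : ℝ :=
  open scoped Classical in
  if 0 < A T then sInf {t | t ∈ Icc 0 T ∧ 0 < A t} else T + 1

theorem startTime_of_pos {A : IncreasingPath T} (h : 0 < A T) :
    startTime A = sInf {t | t ∈ Icc 0 T ∧ 0 < A t} := if_pos h

theorem startTime_of_not_pos {A : IncreasingPath T} (h : ¬ 0 < A T) : startTime A = T + 1 :=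
  if_neg h

theorem startTime_mem {A : IncreasingPath T} (h : 0 < A T) : startTime A ∈ Icc 0 T := by
  rw [startTime_of_pos h]
  exact ⟨Real.sInf_nonneg fun t ht => ht.1.1,
    csInf_le ⟨0, fun t ht => ht.1.1⟩ ⟨⟨hT.out.le, le_rfl⟩, h⟩⟩

theorem startTime_le_iff_pos {A : IncreasingPath T} : startTime A ≤ T ↔ 0 < A T := by
  refine ⟨fun h => ?_, fun h => (startTime_mem h).2⟩
  by_contra h'
  rw [startTime_of_not_pos h'] at h
  linarith

theorem startTime_le_of_pos {A : IncreasingPath T} {t : ℝ} (ht : t ∈ Icc 0 T) (h : 0 < A t) :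
    startTime A ≤ t := by
  rw [startTime_of_pos (h.trans_le (A.eval_le t))]
  exact csInf_le ⟨0, fun t ht => ht.1.1⟩ ⟨ht, h⟩

theorem pos_of_startTime_lt {A : IncreasingPath T} {t : ℝ} (ht : t ≤ T) (h : startTime A < t) :
    0 < A t := by
  have hp : 0 < A T := startTime_le_iff_pos.1 (h.le.trans ht)
  rw [startTime_of_pos hp] at h
  obtain ⟨u, hu, hut⟩ := exists_lt_of_csInf_lt (s := {t | t ∈ Icc 0 T ∧ 0 < A t})
    ⟨T, ⟨hT.out.le, le_rfl⟩, hp⟩ h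
  exact hu.2.trans_le (A.eval_mono hut.le)

theorem firstPositive_eq_top_iff {A : IncreasingPath T} :
    firstPositive A = ⊤ ↔ ¬ 0 < A T := by
  rw [firstPositive, sInf_eq_top]
  constructor
  · intro h hp
    exact EReal.coe_ne_top T (h _ (mem_image_of_mem _ (show T ∈ {t | t ∈ Icc 0 T ∧ 0 < A t} from
      ⟨⟨hT.out.le, le_rfl⟩, hp⟩)))
  · rintro h _ ⟨t, ht, rfl⟩
    exact absurd (ht.2.trans_le (A.eval_le t)) h

theorem firstPositive_of_pos {A : IncreasingPath T} (h : 0 < A T) :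
    firstPositive A = (startTime A : EReal) := by
  have hne : {t | t ∈ Icc 0 T ∧ 0 < A t}.Nonempty := ⟨T, ⟨hT.out.le, le_rfl⟩, h⟩
  have hbdd : BddBelow {t | t ∈ Icc 0 T ∧ 0 < A t} := ⟨0, fun t ht => ht.1.1⟩
  rw [startTime_of_pos h, firstPositive]
  refine le_antisymm ?_ ?_
  · refine EReal.le_of_forall_lt_iff_le.1 fun z hz => ?_
    obtain ⟨u, hu, hut⟩ := exists_lt_of_csInf_lt hne (EReal.coe_lt_coe_iff.1 hz)
    exact (sInf_le (mem_image_of_mem _ hu)).trans (EReal.coe_le_coe_iff.2 hut.le)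
  · refine le_sInf ?_
    rintro _ ⟨t, ht, rfl⟩
    exact EReal.coe_le_coe_iff.2 (csInf_le hbdd ht)

theorem startTime_mem_or (A : IncreasingPath T) : startTime A ∈ Icc 0 T ∨ startTime A = T + 1 := by
  by_cases h : 0 < A T
  · exact Or.inl (startTime_mem h)
  · exact Or.inr (startTime_of_not_pos h)

end Paths

section Density

open ProbabilityTheory

variable {Ω X : Type*} {m : MeasurableSpace X} {m₁ mΩ : MeasurableSpace Ω} {mX : MeasurableSpace X}

/-- The conditional probability of `S` given `π` has an `m`-measurable version `u`, in the sense
that `P (S ∩ π⁻¹ B) = ∫_B u dP₀` for all measurable `B`. -/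
def HasDensityOn {mΩ : MeasurableSpace Ω} (m : MeasurableSpace X) {mX : MeasurableSpace X}
    (P₀ : Measure X) (π : Ω → X) (P : Measure Ω)
    (S : Set Ω) : Prop :=
  ∃ u : X → ℝ≥0∞, Measurable[m] u ∧ (P.restrict S).map π = P₀.withDensity u

variable {P₀ : Measure X} {π : Ω → X} {P : Measure Ω}

theorem hasDensityOn_iff (hπ : Measurable π) {S : Set Ω} :
    HasDensityOn m P₀ π P S ↔ ∃ u : X → ℝ≥0∞, Measurable[m] u ∧
      ∀ B, MeasurableSet B → P (π ⁻¹' B ∩ S) = ∫⁻ x in B, u x ∂P₀ := by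
  refine exists_congr fun u => and_congr_right fun _ => ⟨fun h B hB => ?_, fun h => ?_⟩
  · rw [← withDensity_apply _ hB, ← h, Measure.map_apply hπ hB, Measure.restrict_apply (hπ hB)]
  · refine Measure.ext fun B hB => ?_
    rw [withDensity_apply _ hB, ← h B hB, Measure.map_apply hπ hB,
      Measure.restrict_apply (hπ hB)]

theorem HasDensityOn.mono {m m' : MeasurableSpace X} {mX : MeasurableSpace X} {P₀ : Measure X}
    (h : HasDensityOn m P₀ π P S) (hm : m ≤ m') :
    HasDensityOn m' P₀ π P S :=
  let ⟨u, hu, h⟩ := h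
  ⟨u, hu.mono hm le_rfl, h⟩

theorem hasDensityOn_univ (hP : P.map π = P₀) : HasDensityOn m P₀ π P univ :=
  ⟨1, measurable_const, by simp [hP]⟩

theorem HasDensityOn.compl [IsFiniteMeasure P] (hm : m ≤ mX) (hπ : Measurable π)
    (hP : P.map π = P₀) {S : Set Ω} (hS : MeasurableSet S) (h : HasDensityOn m P₀ π P S) :
    HasDensityOn m P₀ π P Sᶜ := by
  have : IsFiniteMeasure P₀ := hP ▸ inferInstance
  rw [hasDensityOn_iff hπ] at h ⊢
  obtain ⟨u, hu, h⟩ := h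
  have hu' : Measurable u := hu.mono hm le_rfl
  have hle : u ≤ᵐ[P₀] fun _ => 1 := by
    refine ae_le_of_forall_setLIntegral_le_of_sigmaFinite hu' fun B hB _ => ?_
    rw [← h B hB]
    simp only [lintegral_const, one_mul, Measure.restrict_apply_univ]
    rw [← hP, Measure.map_apply hπ hB]
    exact measure_mono inter_subset_left
  refine ⟨fun x => 1 - u x, measurable_const.sub hu, fun B hB => ?_⟩
  have hfin : ∫⁻ x in B, u x ∂P₀ ≠ ∞ := by rw [← h B hB]; exact measure_ne_top _ _
  rw [lintegral_sub hu' hfin (ae_restrict_of_ae hle), ← h B hB]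
  simp only [lintegral_const, one_mul, Measure.restrict_apply_univ]
  rw [← hP, Measure.map_apply hπ hB]
  refine ENNReal.eq_sub_of_add_eq (measure_ne_top _ _) ?_
  rw [← sdiff_eq, add_comm]
  exact measure_inter_add_sdiff _ hS

theorem HasDensityOn.iUnion (hm : m ≤ mX) (hπ : Measurable π) {S : ℕ → Set Ω}
    (hd : Pairwise (Function.onFun Disjoint S))
    (hS : ∀ n, MeasurableSet (S n)) (h : ∀ n, HasDensityOn m P₀ π P (S n)) :
    HasDensityOn m P₀ π P (⋃ n, S n) := by
  simp only [hasDensityOn_iff hπ] at h ⊢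
  choose u hu h using h
  refine ⟨fun x => ∑' n, u n x, @Measurable.tsum X ℝ≥0∞ ℕ m _ _ _ _ _ _ _ _ _ _ _ _ hu,
    fun B hB => ?_⟩
  rw [lintegral_tsum fun n => ((hu n).mono hm le_rfl).aemeasurable, inter_iUnion,
    measure_iUnion (fun i j hij => (hd hij).mono inter_subset_right inter_subset_right)
      (fun n => (hπ hB).inter (hS n))]
  exact tsum_congr fun n => h n B hB

theorem hasDensityOn_of_generateFrom [IsFiniteMeasure P] (hm : m ≤ mX) (hπ : Measurable π)
    (hP : P.map π = P₀) {C : Set (Set Ω)} (hC : IsPiSystem C) (hCm : ∀ S ∈ C, MeasurableSet S)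
    (h : ∀ S ∈ C, HasDensityOn m P₀ π P S) {S : Set Ω}
    (hS : MeasurableSet[MeasurableSpace.generateFrom C] S) : HasDensityOn m P₀ π P S := by
  have hle : MeasurableSpace.generateFrom C ≤ mΩ := MeasurableSpace.generateFrom_le hCm
  induction S, hS using MeasurableSpace.induction_on_inter rfl hC with
  | empty => simpa using (hasDensityOn_univ hP).compl (m := m) hm hπ hP MeasurableSet.univ
  | basic S hS => exact h S hS
  | compl S hS ih => exact ih.compl hm hπ hP (hle _ hS)
  | iUnion S hd hS ih => exact HasDensityOn.iUnion hm hπ hd (fun n => hle _ (hS n)) ih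

theorem HasDensityOn.iInf {m : ℝ → MeasurableSpace X} {mX : MeasurableSpace X} {P₀ : Measure X}
    [IsFiniteMeasure P]
    (hmono : Monotone m) (hm : ∀ s, m s ≤ mX) (hP : P.map π = P₀)
    {t : ℝ} {S : Set Ω} (h : ∀ s, t < s → HasDensityOn (m s) P₀ π P S) :
    HasDensityOn (⨅ (s : ℝ) (_ : t < s), m s) P₀ π P S := by
  have : IsFiniteMeasure P₀ := hP ▸ inferInstance
  have hpos : ∀ n : ℕ, t < t + 1 / ((n : ℝ) + 1) := fun n => by
    have : (0 : ℝ) < 1 / ((n : ℝ) + 1) := by positivity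
    linarith
  choose u hu h using fun n => h _ (hpos n)
  have hu' : ∀ n, Measurable (u n) := fun n => (hu n).mono (hm _) le_rfl
  have hfin : ∀ n, ∫⁻ x, u n x ∂P₀ ≠ ∞ := fun n => by
    rw [← setLIntegral_univ, ← withDensity_apply _ MeasurableSet.univ, ← h n]
    exact measure_ne_top _ _
  have heq : ∀ n, u n =ᵐ[P₀] u 0 := fun n =>
    (withDensity_eq_iff (hu' n).aemeasurable (hu' 0).aemeasurable (hfin n)).1
      ((h n).symm.trans (h 0))
  refine ⟨fun x => limsup (fun n => u n x) atTop, ?_, ?_⟩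
  · intro B hB
    simp only [MeasurableSpace.measurableSet_iInf]
    intro s hs
    obtain ⟨N, hN⟩ := exists_nat_one_div_lt (sub_pos.2 hs)
    have hlim : (fun x => limsup (fun n => u n x) atTop)
        = fun x => limsup (fun n => u (n + N) x) atTop := by
      funext x
      exact (Filter.limsup_nat_add (fun n => u n x) N).symm
    rw [hlim]
    refine Measurable.limsup (mδ := m s) (fun n => (hu (n + N)).mono (hmono ?_) le_rfl) hB
    have h1 : 1 / (((n + N : ℕ) : ℝ) + 1) ≤ 1 / ((N : ℝ) + 1) := by
      apply one_div_le_one_div_of_le (by positivity)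
      push_cast
      have : (0 : ℝ) ≤ n := n.cast_nonneg
      linarith
    linarith
  · rw [h 0]
    refine withDensity_congr_ae ?_
    filter_upwards [ae_all_iff.2 heq] with x hx
    simp [hx]

theorem HasDensityOn.of_preimage {Ω' : Type*} {mΩ' : MeasurableSpace Ω'} {F : Ω' → Ω}
    {Q : Measure Ω'} (hF : Measurable F) (hπ : Measurable π) {S : Set Ω} (hS : MeasurableSet S)
    (h : HasDensityOn m P₀ (π ∘ F) Q (F ⁻¹' S)) : HasDensityOn m P₀ π (Q.map F) S := by
  obtain ⟨u, hu, h⟩ := h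
  refine ⟨u, hu, ?_⟩
  rw [← h, Measure.restrict_map hF hS, Measure.map_map hπ hF]

theorem HasDensityOn.compProd [IsFiniteMeasure P] {Y : Type*} {mY : MeasurableSpace Y}
    {κ : Kernel X Y} [IsFiniteKernel κ] (hm : m ≤ mX) (hπ : Measurable π)
    {S : Set Ω} {R : Set Y} (hS : MeasurableSet S) (hR : MeasurableSet R)
    (h : HasDensityOn m P₀ π P S)
    (hκ : ∃ v : X → ℝ≥0∞, Measurable[m] v ∧ (fun x => κ x R) =ᵐ[P₀] v) :
    HasDensityOn m P₀ (fun p : Ω × Y => π p.1) (P ⊗ₘ κ.comap π hπ) (S ×ˢ R) := by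
  obtain ⟨u, hu, h⟩ := h
  obtain ⟨v, hv, hκ⟩ := hκ
  refine (hasDensityOn_iff (hπ.comp measurable_fst)).2 ⟨u * v, hu.mul hv, fun B hB => ?_⟩
  have hset : (fun p : Ω × Y => π p.1) ⁻¹' B ∩ S ×ˢ R = (π ⁻¹' B ∩ S) ×ˢ R := by
    ext p; simp [and_assoc]
  have hu' : Measurable u := hu.mono hm le_rfl
  have hκR : Measurable fun x => κ x R := κ.measurable_coe hR
  change (P ⊗ₘ κ.comap π hπ) ((fun p : Ω × Y => π p.1) ⁻¹' B ∩ S ×ˢ R) = _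
  rw [hset, Measure.compProd_apply_prod ((hπ hB).inter hS) hR]
  simp only [Kernel.comap_apply]
  rw [← Measure.restrict_restrict (hπ hB), ← setLIntegral_map hB hκR hπ, h,
    restrict_withDensity hB, lintegral_withDensity_eq_lintegral_mul _ hu' hκR]
  refine lintegral_congr_ae ?_
  filter_upwards [ae_restrict_of_ae hκ] with x hx
  simp [hx]

theorem HasDensityOn.condDistrib [IsFiniteMeasure P] {τ : Ω → ℝ} (hm : m ≤ mX)
    (hπ : Measurable π) (hτ : Measurable τ) (hP : P.map π = P₀) {R : Set ℝ} (hR : MeasurableSet R)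
    (h : HasDensityOn m P₀ π P (τ ⁻¹' R)) :
    ∃ v : X → ℝ≥0∞, Measurable[m] v ∧ (fun x => condDistrib τ π P x R) =ᵐ[P₀] v := by
  have : IsFiniteMeasure P₀ := hP ▸ inferInstance
  obtain ⟨u, hu, h⟩ := (hasDensityOn_iff hπ).1 h
  refine ⟨u, hu, ?_⟩
  refine ae_eq_of_forall_setLIntegral_eq_of_sigmaFinite (Kernel.measurable_coe _ hR)
    (hu.mono hm le_rfl) fun B hB _ => ?_
  rw [← h B hB, ← hP, ← Measure.compProd_apply_prod hB hR,
    compProd_map_condDistrib hτ.aemeasurable, Measure.map_apply (hπ.prodMk hτ) (hB.prod hR)]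
  rfl

theorem integrable_indicator_one [IsFiniteMeasure P] {S : Set Ω} (hS : MeasurableSet S) :
    Integrable (S.indicator fun _ => (1 : ℝ)) P :=
  (integrable_const 1).indicator hS

theorem hasDensityOn_of_condIndepGiven [IsFiniteMeasure P] (hm : m ≤ mX) (hπ : Measurable π)
    (hP : P.map π = P₀) (hm₁ : m₁ ≤ mΩ)
    (h : CondIndepGiven (m.comap π) m₁ (mX.comap π) P) {S : Set Ω} (hS : MeasurableSet[m₁] S) :
    HasDensityOn m P₀ π P S := by
  have hmΩ : m.comap π ≤ mΩ := (MeasurableSpace.comap_mono hm).trans hπ.comap_le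
  obtain ⟨w, hw, hvw⟩ := StronglyMeasurable.exists_eq_measurable_comp (mY := m) (f := π)
    (stronglyMeasurable_condExp (m := m.comap π) (μ := P) (f := S.indicator fun _ => (1 : ℝ)))
  have hv0 : 0 ≤ᵐ[P] P[S.indicator (fun _ => (1 : ℝ)) | m.comap π] :=
    condExp_nonneg (Eventually.of_forall fun x => indicator_nonneg (fun _ _ => zero_le_one) x)
  have hw' : Measurable w := hw.measurable.mono hm le_rfl
  refine (hasDensityOn_iff hπ).2 ⟨fun x => ENNReal.ofReal (w x),
    hw.measurable.ennreal_ofReal, fun B hB => ?_⟩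
  have key : ∫ x in π ⁻¹' B, (P[S.indicator (fun _ => (1 : ℝ)) | m.comap π]) x ∂P
      = P.real (S ∩ π ⁻¹' B) := by
    have hB' := integrable_indicator_one (P := P) (hπ hB)
    have hprod : (P[S.indicator (fun _ => (1 : ℝ)) | m.comap π])
        * (π ⁻¹' B).indicator (fun _ => (1 : ℝ))
        = (π ⁻¹' B).indicator (P[S.indicator (fun _ => (1 : ℝ)) | m.comap π]) := by
      funext x
      by_cases hx : x ∈ π ⁻¹' B <;> simp [hx]
    have hint : Integrable ((P[S.indicator (fun _ => (1 : ℝ)) | m.comap π])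
        * (π ⁻¹' B).indicator (fun _ => (1 : ℝ))) P := by
      rw [hprod]; exact integrable_condExp.indicator (hπ hB)
    rw [← integral_indicator (hπ hB), ← hprod, ← integral_condExp hmΩ,
      integral_congr_ae
        (condExp_mul_of_stronglyMeasurable_left stronglyMeasurable_condExp hint hB'),
      ← integral_congr_ae (h S (π ⁻¹' B) hS ⟨B, hB, rfl⟩), integral_condExp hmΩ]
    rw [integral_indicator_const _ ((hm₁ _ hS).inter (hπ hB))]
    simp
  rw [← hP, setLIntegral_map hB hw'.ennreal_ofReal hπ]
  have : (fun x => ENNReal.ofReal (w (π x)))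
      = fun x => ENNReal.ofReal ((P[S.indicator (fun _ => (1 : ℝ)) | m.comap π]) x) := by
    rw [hvw]; rfl
  rw [this, ← ofReal_integral_eq_lintegral_ofReal integrable_condExp.integrableOn
    (ae_restrict_of_ae hv0), key, inter_comm, ofReal_measureReal]

theorem condIndepGiven_of_hasDensityOn [IsFiniteMeasure P] (hm : m ≤ mX) (hπ : Measurable π)
    (hP : P.map π = P₀) (hm₁ : m₁ ≤ mΩ)
    (h : ∀ S, MeasurableSet[m₁] S → HasDensityOn m P₀ π P S) :
    CondIndepGiven (m.comap π) m₁ (mX.comap π) P := by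
  have hmΩ : m.comap π ≤ mΩ := (MeasurableSpace.comap_mono hm).trans hπ.comap_le
  rintro S _ hS ⟨D, hD, rfl⟩
  obtain ⟨u, hu, hu2⟩ := (hasDensityOn_iff hπ).1 (h S hS)
  have hu' : Measurable u := hu.mono hm le_rfl
  have huint : ∫⁻ x, u x ∂P₀ ≠ ∞ := by
    rw [← setLIntegral_univ, ← hu2 _ MeasurableSet.univ]; exact measure_ne_top _ _
  set r : Ω → ℝ := fun ω => (u (π ω)).toReal with hr
  have hrm : StronglyMeasurable[m.comap π] r :=
    (hu.ennreal_toReal.comp (comap_measurable π)).stronglyMeasurable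
  have hrint : Integrable r P := by
    refine integrable_toReal_of_lintegral_ne_top (hu'.comp hπ).aemeasurable ?_
    rw [← lintegral_map hu' hπ, hP]; exact huint
  have hfinae : ∀ᵐ ω ∂P, u (π ω) < ∞ := by
    refine ae_lt_top (hu'.comp hπ) ?_
    rw [← lintegral_map hu' hπ, hP]; exact huint
  have hset : ∀ B, MeasurableSet B → ∫ ω in π ⁻¹' B, r ω ∂P = P.real (π ⁻¹' B ∩ S) := by
    intro B hB
    rw [hr, integral_toReal (f := fun ω => u (π ω)) (hu'.comp hπ).aemeasurable
        (ae_restrict_of_ae hfinae),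
      ← setLIntegral_map hB hu' hπ, hP, ← hu2 B hB]
    rfl
  have main : ∀ D, MeasurableSet D →
      P[(S ∩ π ⁻¹' D).indicator (fun _ => (1 : ℝ)) | m.comap π]
        =ᵐ[P] r * P[(π ⁻¹' D).indicator (fun _ => (1 : ℝ)) | m.comap π] := by
    intro D hD
    have hprod : r * (π ⁻¹' D).indicator (fun _ => (1 : ℝ)) = (π ⁻¹' D).indicator r := by
      funext x
      by_cases hx : x ∈ π ⁻¹' D <;> simp [hx]
    have hint : Integrable (r * (π ⁻¹' D).indicator (fun _ => (1 : ℝ))) P := by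
      rw [hprod]; exact hrint.indicator (hπ hD)
    refine EventuallyEq.trans ?_ (condExp_mul_of_stronglyMeasurable_left hrm hint
      (integrable_indicator_one (hπ hD)))
    refine (ae_eq_condExp_of_forall_setIntegral_eq hmΩ hint
      (fun _ _ _ => integrable_condExp.integrableOn) ?_
      stronglyMeasurable_condExp.aestronglyMeasurable)
    rintro _ ⟨C, hC, rfl⟩ -
    have hSD : MeasurableSet (S ∩ π ⁻¹' D) := (hm₁ _ hS).inter (hπ hD)
    rw [setIntegral_condExp hmΩ (integrable_indicator_one hSD) ⟨C, hC, rfl⟩, hprod,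
      setIntegral_indicator (hπ hD), setIntegral_indicator hSD, ← preimage_inter,
      hset _ ((hm _ hC).inter hD)]
    simp only [integral_const, smul_eq_mul, mul_one, MeasurableSet.univ, measureReal_restrict_apply,
      univ_inter]
    congr 1
    ext x
    simp only [mem_inter_iff, mem_preimage]
    tauto
  have h1 := main D hD
  have h2 := main univ MeasurableSet.univ
  rw [preimage_univ, inter_univ, indicator_univ, condExp_const hmΩ] at h2
  filter_upwards [h1, h2] with ω h1 h2
  rw [h1, Pi.mul_apply, Pi.mul_apply, h2, Pi.mul_apply, mul_one]

end Density

section Gluing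

open ProbabilityTheory

variable {d : ℕ} {T : ℝ}

/-- The `σ`-algebra `σ(x_r ; r ≤ s)` on the path space of the target. -/
@[reducible] def pathSigma (d : ℕ) (T : ℝ) (s : ℝ) :
    MeasurableSpace (CadlagPath T (EuclideanSpace ℝ (Fin d))) :=
  ⨆ (r : Icc (0 : ℝ) T) (_ : (r : ℝ) ≤ s),
    MeasurableSpace.comap (fun x : CadlagPath T (EuclideanSpace ℝ (Fin d)) => x.toFun r)
      inferInstance

/-- The right-continuous enlargement of `pathSigma`. -/
@[reducible] def pathSigmaPlus (d : ℕ) (T : ℝ) (t : ℝ) :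
    MeasurableSpace (CadlagPath T (EuclideanSpace ℝ (Fin d))) :=
  ⨅ (s : ℝ) (_ : t < s), pathSigma d T s

theorem pathSigma_mono : Monotone (pathSigma d T) := fun _ _ h =>
  iSup_mono fun _ => iSup_mono' fun h' => ⟨h'.trans h, le_rfl⟩

theorem pathSigma_le (s : ℝ) : pathSigma d T s ≤
    (inferInstance : MeasurableSpace (CadlagPath T (EuclideanSpace ℝ (Fin d)))) :=
  iSup₂_le fun r _ => (measurable_toFun r).comap_le

theorem pathSigma_eq_of_le {s : ℝ} (h : T ≤ s) : pathSigma d T s =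
    (inferInstance : MeasurableSpace (CadlagPath T (EuclideanSpace ℝ (Fin d)))) := by
  refine le_antisymm (pathSigma_le s) ?_
  change MeasurableSpace.comap CadlagPath.toFun (⨆ r, MeasurableSpace.comap _ _) ≤ _
  rw [MeasurableSpace.comap_iSup]
  refine iSup_le fun r => ?_
  rw [MeasurableSpace.comap_comp]
  exact le_iSup₂_of_le r (r.2.2.trans h) le_rfl

theorem pathSigmaPlus_le (t : ℝ) : pathSigmaPlus d T t ≤
    (inferInstance : MeasurableSpace (CadlagPath T (EuclideanSpace ℝ (Fin d)))) :=
  (iInf₂_le (t + 1) (by linarith)).trans (pathSigma_le _)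

theorem pathSigmaPlus_le_pathSigma {t s : ℝ} (h : t < s) : pathSigmaPlus d T t ≤ pathSigma d T s :=
  iInf₂_le s h

theorem sigmaL_eq (s : ℝ) : sigmaL d T s = (pathSigma d T s).comap Prod.fst := by
  simp only [sigmaL, pathSigma, MeasurableSpace.comap_iSup, MeasurableSpace.comap_comp]
  rfl

instance : Nonempty (IncreasingPath T) :=
  ⟨.ofRightContinuous (fun _ => 0) monotone_const (fun _ => le_rfl)
    (fun _ => continuousWithinAt_const)⟩

theorem sigmaLPlus_eq (t : ℝ) : sigmaLPlus d T t = (pathSigmaPlus d T t).comap Prod.fst := by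
  refine le_antisymm (fun S hS => ?_) ?_
  · have hS' : ∀ s, t < s → ∃ B, MeasurableSet[pathSigma d T s] B ∧ Prod.fst ⁻¹' B = S := by
      intro s hs
      have := (iInf₂_le s hs : sigmaLPlus d T t ≤ sigmaL d T s) S hS
      rwa [sigmaL_eq] at this
    obtain ⟨B, -, rfl⟩ := hS' (t + 1) (by linarith)
    refine ⟨B, ?_, rfl⟩
    refine MeasurableSpace.measurableSet_iInf.2 fun s =>
      MeasurableSpace.measurableSet_iInf.2 fun hs => ?_
    obtain ⟨B', hB', h⟩ := hS' s hs
    rwa [← Prod.fst_surjective.preimage_injective h]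
  · refine le_iInf₂ fun s hs => ?_
    rw [sigmaL_eq]
    exact MeasurableSpace.comap_mono (pathSigmaPlus_le_pathSigma hs)

theorem sigmaL_eq_comap : sigmaL d T T = MeasurableSpace.comap Prod.fst
    (inferInstance : MeasurableSpace (CadlagPath T (EuclideanSpace ℝ (Fin d)))) := by
  rw [sigmaL_eq, pathSigma_eq_of_le le_rfl]

theorem sigmaA_le (s : ℝ) : sigmaA d T s ≤
    (inferInstance : MeasurableSpace (PathPair d T)) :=
  iSup₂_le fun r _ => ((measurable_increasing_toFun r).comp measurable_snd).comap_le

theorem measurable_sigmaA {r : Icc (0 : ℝ) T} {t : ℝ} (h : (r : ℝ) ≤ t) :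
    Measurable[sigmaA d T t] fun ω : PathPair d T => ω.2.toFun r := by
  rw [measurable_iff_comap_le]
  exact le_iSup₂_of_le (f := fun (r : Icc (0 : ℝ) T) (_ : (r : ℝ) ≤ t) =>
    MeasurableSpace.comap (fun ω : PathPair d T => ω.2.toFun r) inferInstance) r h le_rfl

/-- Admissibility in terms of conditional probabilities given the whole path of the target. -/
theorem admissible_iff {P₀ : Measure (CadlagPath T (EuclideanSpace ℝ (Fin d)))}
    {P : Measure (PathPair d T)} [IsFiniteMeasure P] :
    Admissible P₀ P ↔ P.map Prod.fst = P₀ ∧ ∀ t ∈ Icc (0 : ℝ) T, ∀ S,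
      MeasurableSet[sigmaA d T t] S → HasDensityOn (pathSigmaPlus d T t) P₀ Prod.fst P S := by
  constructor
  · rintro ⟨h1, h2⟩
    refine ⟨h1, fun t ht S hS => ?_⟩
    have h3 := h2 t ht
    rw [sigmaLPlus_eq, sigmaL_eq_comap] at h3
    exact hasDensityOn_of_condIndepGiven (pathSigmaPlus_le t) measurable_fst h1 (sigmaA_le t) h3 hS
  · rintro ⟨h1, h2⟩
    refine ⟨h1, fun t ht => ?_⟩
    rw [sigmaLPlus_eq, sigmaL_eq_comap]
    exact condIndepGiven_of_hasDensityOn (pathSigmaPlus_le t) measurable_fst h1 (sigmaA_le t)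
      (h2 t ht)

/-- The pair consisting of the target and the modified control. -/
def replaceMap (ε : ℝ≥0) (p : PathPair d T × ℝ) : PathPair d T :=
  (p.1.1, p.1.2.replaceBottom ε p.2)

theorem measurable_replaceMap (ε : ℝ≥0) : Measurable (replaceMap (d := d) (T := T) ε) :=
  (measurable_fst.comp measurable_fst).prodMk
    ((measurable_replaceBottom ε).comp
      ((measurable_snd.comp measurable_fst).prodMk measurable_snd))

/-- The `σ`-algebra on `ℝ` generated by the half-lines `(-∞,r]`, `r ≤ t`. -/
@[reducible] def stopSigma (t : ℝ) : MeasurableSpace ℝ :=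
  MeasurableSpace.generateFrom (Iic '' Iic t)

theorem stopSigma_le (t : ℝ) : stopSigma t ≤ (inferInstance : MeasurableSpace ℝ) :=
  MeasurableSpace.generateFrom_le (by rintro _ ⟨r, -, rfl⟩; exact measurableSet_Iic)

theorem measurable_replaceMap_sigmaA (ε : ℝ≥0) (t : ℝ) :
    @Measurable _ _ ((sigmaA d T t).prod (stopSigma t)) (sigmaA d T t)
      (replaceMap (d := d) (T := T) ε) := by
  rw [measurable_iff_comap_le, sigmaA, MeasurableSpace.comap_iSup]
  refine iSup_le fun r => ?_
  rw [MeasurableSpace.comap_iSup]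
  refine iSup_le fun hr => ?_
  rw [MeasurableSpace.comap_comp, ← measurable_iff_comap_le]
  have h1 : @Measurable _ _ ((sigmaA d T t).prod (stopSigma t)) _
      fun p : PathPair d T × ℝ => p.1.2.toFun r :=
    (measurable_sigmaA hr).comp (@measurable_fst _ _ (sigmaA d T t) (stopSigma t))
  have h2 : @MeasurableSet _ ((sigmaA d T t).prod (stopSigma t))
      {p : PathPair d T × ℝ | p.2 ≤ r} :=
    @measurable_snd _ _ (sigmaA d T t) (stopSigma t) _
      (MeasurableSpace.measurableSet_generateFrom ⟨(r : ℝ), hr, rfl⟩)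
  exact ((h1.sub_const _).max measurable_const).add
    (Measurable.ite h2 measurable_const measurable_const)

variable [hT : Fact (0 < T)]

theorem measurableSet_sigmaA_pos {t : ℝ} (ht : t ∈ Icc 0 T) {s : ℝ} (hts : t ≤ s) :
    MeasurableSet[sigmaA d T s] {ω : PathPair d T | 0 < ω.2 t} := by
  have h := measurable_sigmaA (d := d) (r := ⟨t, ht⟩) hts
  have h2 : {ω : PathPair d T | 0 < ω.2 t} = (fun ω => ω.2.toFun ⟨t, ht⟩) ⁻¹' Ioi 0 := by
    ext ω
    simp [IncreasingPath.eval, projIcc_of_mem _ ht]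
  rw [h2]
  exact h measurableSet_Ioi

theorem startTime_nonneg (A : IncreasingPath T) : 0 ≤ startTime A := by
  rcases startTime_mem_or A with h | h
  · exact h.1
  · rw [h]; linarith [hT.out]

theorem startTime_le_iff {A : IncreasingPath T} {r s : ℝ} (hr : 0 ≤ r) (hrs : r < s) (hs : s ≤ T) :
    startTime A ≤ r ↔ ∀ q : ℚ, (q : ℝ) ∈ Ioo r s → 0 < A q := by
  constructor
  · intro h q hq
    exact pos_of_startTime_lt (hq.2.le.trans hs) (h.trans_lt hq.1)
  · intro h
    by_contra! hlt
    obtain ⟨q, hq1, hq2⟩ := exists_rat_btwn (lt_min hlt hrs)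
    have hqs := hq2.trans_le (min_le_right _ _)
    exact absurd (startTime_le_of_pos ⟨hr.trans hq1.le, hqs.le.trans hs⟩ (h q ⟨hq1, hqs⟩))
      (not_le.2 (hq2.trans_le (min_le_left _ _)))

theorem measurableSet_startTime_le {r s : ℝ} (hrs : r < s) (hs : s ≤ T) :
    MeasurableSet[sigmaA d T s] {ω : PathPair d T | startTime ω.2 ≤ r} := by
  rcases lt_or_ge r 0 with hr | hr
  · have : {ω : PathPair d T | startTime ω.2 ≤ r} = ∅ := by
      ext ω
      simpa using hr.trans_le (startTime_nonneg ω.2)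
    rw [this]
    exact @MeasurableSet.empty _ (sigmaA d T s)
  · have : {ω : PathPair d T | startTime ω.2 ≤ r}
        = ⋂ (q : ℚ) (_ : (q : ℝ) ∈ Ioo r s), {ω : PathPair d T | 0 < ω.2 q} := by
      ext ω
      simp only [mem_ofPred_eq, mem_iInter]
      exact startTime_le_iff hr hrs hs
    rw [this]
    refine MeasurableSet.iInter fun q => MeasurableSet.iInter fun hq => ?_
    exact measurableSet_sigmaA_pos ⟨hr.trans hq.1.le, hq.2.le.trans hs⟩ hq.2.le

theorem measurableSet_startTime_le_right {r : ℝ} (hr : r ≤ T) :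
    MeasurableSet[sigmaA d T T] {ω : PathPair d T | startTime ω.2 ≤ r} := by
  rcases hr.lt_or_eq with h | rfl
  · exact measurableSet_startTime_le h le_rfl
  · simp only [startTime_le_iff_pos]
    exact measurableSet_sigmaA_pos ⟨hT.out.le, le_rfl⟩ le_rfl

theorem measurable_startTime_snd : Measurable fun ω : PathPair d T => startTime ω.2 := by
  refine measurable_of_Iic fun r => ?_
  rcases le_or_gt r T with h | h
  · exact sigmaA_le T _ (measurableSet_startTime_le_right h)
  · rcases lt_or_ge r (T + 1) with h' | h'
    · have : (fun ω : PathPair d T => startTime ω.2) ⁻¹' Iic r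
          = {ω : PathPair d T | startTime ω.2 ≤ T} := by
        ext ω
        simp only [mem_preimage, mem_Iic, mem_ofPred_eq]
        rcases startTime_mem_or ω.2 with h2 | h2
        · simp [h2.2, h2.2.trans h.le]
        · rw [h2]; constructor <;> intro <;> linarith
      rw [this]
      exact sigmaA_le T _ (measurableSet_startTime_le_right le_rfl)
    · convert MeasurableSet.univ
      ext ω
      simp only [mem_preimage, mem_Iic, mem_univ, iff_true]
      rcases startTime_mem_or ω.2 with h2 | h2
      · exact h2.2.trans h.le
      · rw [h2]; exact h'

variable {P₀ : Measure (CadlagPath T (EuclideanSpace ℝ (Fin d)))} {P : Measure (PathPair d T)}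

theorem hasDensityOn_startTime [IsFiniteMeasure P] (h : Admissible P₀ P) {t : ℝ}
    (ht : t ∈ Icc 0 T) {R : Set ℝ} (hR : MeasurableSet[stopSigma t] R) :
    HasDensityOn (pathSigmaPlus d T t) P₀ Prod.fst P
      ((fun ω : PathPair d T => startTime ω.2) ⁻¹' R) := by
  obtain ⟨h1, h2⟩ := admissible_iff.1 h
  have hR' : MeasurableSet[(stopSigma t).comap fun ω : PathPair d T => startTime ω.2]
      ((fun ω : PathPair d T => startTime ω.2) ⁻¹' R) := ⟨R, hR, rfl⟩
  rw [stopSigma, MeasurableSpace.comap_generateFrom] at hR'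
  refine hasDensityOn_of_generateFrom (pathSigmaPlus_le t) measurable_fst h1 ?_ ?_ ?_ hR'
  · rw [← image_comp]
    rintro _ ⟨r, hr, rfl⟩ _ ⟨r', hr', rfl⟩ -
    exact ⟨min r r', (min_le_left r r').trans (mem_Iic.1 hr),
      by simp [← preimage_inter, Iic_inter_Iic]⟩
  · rintro _ ⟨_, ⟨r, hr, rfl⟩, rfl⟩
    exact measurable_startTime_snd measurableSet_Iic
  · rintro _ ⟨_, ⟨r, hr, rfl⟩, rfl⟩
    rcases ht.2.lt_or_eq with htT | rfl
    · refine HasDensityOn.iInf pathSigma_mono pathSigma_le h1 fun s hs => ?_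
      obtain ⟨u, hu1, hu2⟩ := exists_between (lt_min hs htT)
      refine HasDensityOn.mono ?_ (pathSigmaPlus_le_pathSigma (hu2.trans_le (min_le_left _ _)))
      have huT : u ≤ T := hu2.le.trans (min_le_right _ _)
      exact h2 u ⟨ht.1.trans hu1.le, huT⟩ _ (measurableSet_startTime_le (lt_of_le_of_lt hr hu1) huT)
    · exact h2 _ ht _ (measurableSet_startTime_le_right hr)

/-- Given two admissible controls, the start time of the second one can be realized on an extension
of the space of the first one, in such a way that replacing the bottom part of the first
control by a jump at that time is admissible. -/
theorem exists_gluing {P P' : Measure (PathPair d T)} [IsProbabilityMeasure P]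
    [IsProbabilityMeasure P'] (h : Admissible P₀ P) (h' : Admissible P₀ P') :
    ∃ Q : Measure (PathPair d T × ℝ), IsProbabilityMeasure Q ∧ Q.map Prod.fst = P ∧
      Q.map (fun p => (p.1.1, p.2)) = P'.map (fun ω => (ω.1, startTime ω.2)) ∧
      ∀ ε, Admissible P₀ (Q.map (replaceMap ε)) := by
  have : IsProbabilityMeasure P₀ := by
    rw [← h.marginal]; exact Measure.isProbabilityMeasure_map measurable_fst.aemeasurable
  set κ := condDistrib (fun ω : PathPair d T => startTime ω.2) Prod.fst P' with hκ
  have hQfst : (P ⊗ₘ κ.comap Prod.fst measurable_fst).map Prod.fst = P :=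
    Measure.fst_compProd _ _
  refine ⟨P ⊗ₘ κ.comap Prod.fst measurable_fst, inferInstance, hQfst, ?_, fun ε => ?_⟩
  · rw [← compProd_map_condDistrib measurable_startTime_snd.aemeasurable, h'.marginal,
      ← h.marginal, ← hκ]
    refine Measure.ext_of_lintegral _ fun f hf => ?_
    rw [lintegral_map hf (by fun_prop), Measure.lintegral_compProd (by fun_prop),
      Measure.lintegral_compProd hf, lintegral_map (by fun_prop) measurable_fst]
    rfl
  · have := Measure.isProbabilityMeasure_map
      (μ := P ⊗ₘ κ.comap Prod.fst measurable_fst) (measurable_replaceMap ε).aemeasurable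
    rw [admissible_iff, Measure.map_map measurable_fst (measurable_replaceMap ε)]
    have hQL : (P ⊗ₘ κ.comap Prod.fst measurable_fst).map (Prod.fst ∘ Prod.fst) = P₀ := by
      rw [← Measure.map_map measurable_fst measurable_fst, hQfst, h.marginal]
    refine ⟨hQL, fun t ht S hS => ?_⟩
    refine HasDensityOn.of_preimage (measurable_replaceMap ε) measurable_fst
      (sigmaA_le t _ hS) ?_
    have hS' : MeasurableSet[(sigmaA d T t).prod (stopSigma t)] (replaceMap ε ⁻¹' S) :=
      measurable_replaceMap_sigmaA ε t hS
    have hgen : (sigmaA d T t).prod (stopSigma t) = _ :=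
      (@generateFrom_prod _ _ (sigmaA d T t) (stopSigma t)).symm
    rw [hgen] at hS'
    refine hasDensityOn_of_generateFrom (pathSigmaPlus_le t)
      (measurable_fst.comp (measurable_replaceMap ε)) hQL
      (@isPiSystem_prod _ _ (sigmaA d T t) (stopSigma t)) ?_ ?_ hS'
    · rintro _ ⟨S, hS, R, hR, rfl⟩
      exact (sigmaA_le t _ hS).prod (stopSigma_le t _ hR)
    · rintro _ ⟨S, hS, R, hR, rfl⟩
      refine HasDensityOn.compProd (pathSigmaPlus_le t) measurable_fst (sigmaA_le t _ hS)
        (stopSigma_le t _ hR) ((admissible_iff.1 h).2 t ht S hS) ?_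
      exact HasDensityOn.condDistrib (pathSigmaPlus_le t) measurable_fst measurable_startTime_snd
        h'.marginal (stopSigma_le t _ hR) (hasDensityOn_startTime h' ht hR)

end Gluing

section Scalar

variable {φ : ℝ → ℝ}

theorem tangent_le (hc : ConvexOn ℝ (Ici 0) φ) (hd : DifferentiableOn ℝ φ (Ici 0)) {x y : ℝ}
    (hx : 0 ≤ x) (hy : 0 ≤ y) : φ x + derivWithin φ (Ici 0) x * (y - x) ≤ φ y := by
  have h := (hd x hx).hasDerivWithinAt
  rcases lt_trichotomy x y with hxy | rfl | hxy
  · have := hc.le_slope_of_hasDerivWithinAt hx hy hxy h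
    rw [slope_def_field, le_div_iff₀ (sub_pos.2 hxy)] at this
    linarith
  · simp
  · have := hc.slope_le_of_hasDerivWithinAt hy hx hxy h
    rw [slope_def_field, div_le_iff₀ (sub_pos.2 hxy)] at this
    linarith

theorem derivWithin_zero_le (hc : ConvexOn ℝ (Ici 0) φ) (hd : DifferentiableOn ℝ φ (Ici 0)) {a : ℝ}
    (ha : 0 ≤ a) : derivWithin φ (Ici 0) 0 ≤ derivWithin φ (Ici 0) a := by
  rcases ha.eq_or_lt with rfl | ha'
  · exact le_rfl
  · have h1 := tangent_le hc hd le_rfl ha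
    have h2 := tangent_le hc hd ha le_rfl
    nlinarith

/-- The error in the first-order expansion of the cost of replacing the bottom part, of height `ε`,
of a control with current value `a`. -/
def bottomError (φ : ℝ → ℝ) (ε a : ℝ) : ℝ :=
  if a = 0 then |derivWithin φ (Ici 0) ε - derivWithin φ (Ici 0) 0|
  else if a < ε then |derivWithin φ (Ici 0) ε| + 2 * |derivWithin φ (Ici 0) 0|
  else 0

theorem bottomError_nonneg (ε a : ℝ) : 0 ≤ bottomError φ ε a := by
  unfold bottomError; split_ifs <;> positivity

theorem replaceBottom_scalar (hc : ConvexOn ℝ (Ici 0) φ) (hd : DifferentiableOn ℝ φ (Ici 0))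
    {a ε : ℝ} (ha : 0 ≤ a) (hε : 0 ≤ ε) (b : Prop) [Decidable b] :
    φ (max (a - ε) 0 + if b then ε else 0)
        + ε * (if 0 < a then derivWithin φ (Ici 0) 0 else 0)
      ≤ φ a + ε * (if b then derivWithin φ (Ici 0) 0 else 0) + ε * bottomError φ ε a := by
  set D := derivWithin φ (Ici 0) with hD
  have e1 := neg_abs_le (D 0)
  have e2 := le_abs_self (D ε)
  have e3 := abs_nonneg (D 0)
  have e4 := abs_nonneg (D ε)
  have e5 := le_abs_self (D ε - D 0)
  have e6 := le_abs_self (D 0)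
  unfold bottomError
  rw [← hD]
  rcases ha.eq_or_lt with rfl | ha'
  · simp only [lt_irrefl, if_false, if_true, zero_sub, mul_zero, add_zero]
    rw [max_eq_right (by linarith)]
    have h := tangent_le hc hd hε le_rfl
    by_cases hb : b
    · simp only [hb, if_true, zero_add]
      nlinarith
    · simp only [hb, if_false, zero_add]
      nlinarith [abs_nonneg (D ε - D 0)]
  · rw [if_pos ha', if_neg ha'.ne']
    rcases lt_or_ge a ε with h | h
    · rw [if_pos h, max_eq_right (by linarith)]
      by_cases hb : b
      · simp only [hb, if_true, zero_add]
        have := tangent_le hc hd hε ha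
        nlinarith
      · simp only [hb, if_false, add_zero, mul_zero]
        have := tangent_le hc hd le_rfl ha
        nlinarith
    · rw [if_neg (not_lt.2 h), max_eq_left (by linarith)]
      by_cases hb : b
      · simp [hb]
      · simp only [hb, if_false, add_zero, mul_zero]
        have h1 := tangent_le hc hd (sub_nonneg.2 h) ha
        have h2 := derivWithin_zero_le hc hd (sub_nonneg.2 h)
        rw [← hD] at h1 h2
        nlinarith

theorem ofReal_balance {x y e u v : ℝ} (ε : ℝ≥0) (hx : 0 ≤ x) (hy : 0 ≤ y) (he : 0 ≤ e)
    (h : x + ε * u ≤ y + ε * v + ε * e) :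
    ENNReal.ofReal x + ε * ENNReal.ofReal u + ε * ENNReal.ofReal (-v)
      ≤ ENNReal.ofReal y + ε * ENNReal.ofReal v + ε * ENNReal.ofReal (-u)
        + ε * ENNReal.ofReal e := by
  have hpos : ∀ r : ℝ, ENNReal.ofReal r = ENNReal.ofReal (max r 0) := fun r => by
    rcases le_total r 0 with h | h <;> simp [h]
  have hεr : (ε : ℝ≥0∞) = ENNReal.ofReal ε := (ENNReal.ofReal_coe_nnreal).symm
  have h0 : (0 : ℝ) ≤ ε := ε.2
  have key : ∀ r : ℝ, max r 0 - max (-r) 0 = r := fun r => by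
    rcases le_total r 0 with h | h <;> simp [h]
  rw [hpos u, hpos v, hpos (-u), hpos (-v), hεr]
  have hu := le_max_right u 0
  have hv := le_max_right v 0
  have hu' := le_max_right (-u) 0
  have hv' := le_max_right (-v) 0
  have k1 := key u
  have k2 := key v
  generalize max u 0 = u1 at *
  generalize max v 0 = v1 at *
  generalize max (-u) 0 = u2 at *
  generalize max (-v) 0 = v2 at *
  subst k1 k2
  simp only [← ENNReal.ofReal_mul h0]
  rw [← ENNReal.ofReal_add hx (by positivity), ← ENNReal.ofReal_add (by positivity) (by positivity),
    ← ENNReal.ofReal_add hy (by positivity), ← ENNReal.ofReal_add (by positivity) (by positivity),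
    ← ENNReal.ofReal_add (by positivity) (by positivity)]
  refine ENNReal.ofReal_le_ofReal ?_
  linarith

theorem replaceBottom_ofReal (h0 : ∀ a, 0 ≤ a → 0 ≤ φ a) (hc : ConvexOn ℝ (Ici 0) φ)
    (hd : DifferentiableOn ℝ φ (Ici 0)) {a : ℝ} (ε : ℝ≥0) (ha : 0 ≤ a) (b : Prop) [Decidable b] :
    ENNReal.ofReal (φ (max (a - ε) 0 + if b then (ε : ℝ) else 0))
        + ε * (if 0 < a then ENNReal.ofReal (derivWithin φ (Ici 0) 0) else 0)
        + ε * (if b then ENNReal.ofReal (-derivWithin φ (Ici 0) 0) else 0)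
      ≤ ENNReal.ofReal (φ a) + ε * (if b then ENNReal.ofReal (derivWithin φ (Ici 0) 0) else 0)
        + ε * (if 0 < a then ENNReal.ofReal (-derivWithin φ (Ici 0) 0) else 0)
        + ε * ENNReal.ofReal (bottomError φ ε a) := by
  have h := ofReal_balance ε
    (h0 _ (add_nonneg (le_max_right (a - ε) 0) (by split_ifs <;> simp))) (h0 a ha)
    (bottomError_nonneg (φ := φ) ε a) (replaceBottom_scalar hc hd ha ε.2 b)
  refine le_trans (le_of_eq ?_) (h.trans (le_of_eq ?_))
  · by_cases hb : b <;> by_cases ha' : 0 < a <;> simp [hb, ha']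
  · by_cases hb : b <;> by_cases ha' : 0 < a <;> simp [hb, ha']

theorem gronwall_bound {Φ M : ℝ} (hΦ : 0 ≤ Φ) (hM : 0 ≤ M) (h0 : ∀ a, 0 ≤ a → 0 ≤ φ a)
    (hd : DifferentiableOn ℝ φ (Ici 0))
    (hg : ∀ a, 0 ≤ a → |derivWithin φ (Ici 0) a| ≤ Φ + M * φ a) {a b R : ℝ} (ha : 0 ≤ a)
    (hb : 0 ≤ b) (hab : |a - b| ≤ R) : φ b ≤ Real.exp ((M + 1) * R) * (φ a + Φ) := by
  have hψ : ∀ x, 0 ≤ x → 0 ≤ φ x + Φ := fun x hx => add_nonneg (h0 x hx) hΦ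
  have hder : ∀ k x : ℝ, 0 < x → HasDerivAt (fun x => Real.exp (k * x) * (φ x + Φ))
      (Real.exp (k * x) * (k * (φ x + Φ) + derivWithin φ (Ici 0) x)) x := by
    intro k x hx
    have h1 : HasDerivAt φ (derivWithin φ (Ici 0) x) x :=
      (hd x hx.le).hasDerivWithinAt.hasDerivAt (Ici_mem_nhds hx)
    have h2 : HasDerivAt (fun x => Real.exp (k * x)) (Real.exp (k * x) * k) x := by
      simpa using ((hasDerivAt_id x).const_mul k).exp
    exact (h2.mul (h1.add_const Φ)).congr_deriv (by ring)
  have hcont : ∀ k : ℝ, ContinuousOn (fun x => Real.exp (k * x) * (φ x + Φ)) (Ici 0) := fun k =>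
    (by fun_prop : Continuous fun x : ℝ => Real.exp (k * x)).continuousOn.mul
      (hd.continuousOn.add continuousOn_const)
  have hdiff : ∀ k : ℝ, DifferentiableOn ℝ (fun x => Real.exp (k * x) * (φ x + Φ))
      (interior (Ici 0)) := fun k x hx => by
    rw [interior_Ici] at hx
    exact (hder k x hx).differentiableAt.differentiableWithinAt
  have hbound : ∀ x, 0 < x → |derivWithin φ (Ici 0) x| ≤ (M + 1) * (φ x + Φ) := fun x hx => by
    nlinarith [hg x hx.le, h0 x hx.le]
  have hanti : AntitoneOn (fun x => Real.exp (-(M + 1) * x) * (φ x + Φ)) (Ici 0) := by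
    refine antitoneOn_of_deriv_nonpos (convex_Ici 0) (hcont _) (hdiff _) fun x hx => ?_
    rw [interior_Ici] at hx
    rw [(hder _ x hx).deriv]
    have := (abs_le.1 (hbound x hx)).2
    exact mul_nonpos_of_nonneg_of_nonpos (Real.exp_pos _).le (by linarith)
  have hmono : MonotoneOn (fun x => Real.exp ((M + 1) * x) * (φ x + Φ)) (Ici 0) := by
    refine monotoneOn_of_deriv_nonneg (convex_Ici 0) (hcont _) (hdiff _) fun x hx => ?_
    rw [interior_Ici] at hx
    rw [(hder _ x hx).deriv]
    have := (abs_le.1 (hbound x hx)).1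
    exact mul_nonneg (Real.exp_pos _).le (by linarith)
  have main : φ b + Φ ≤ Real.exp ((M + 1) * |a - b|) * (φ a + Φ) := by
    rcases le_total a b with h | h
    · have h1 : Real.exp (-(M + 1) * b) * (φ b + Φ) ≤ Real.exp (-(M + 1) * a) * (φ a + Φ) :=
        hanti ha hb h
      have h2 := mul_le_mul_of_nonneg_left h1 (Real.exp_pos ((M + 1) * b)).le
      rw [← mul_assoc, ← mul_assoc, ← Real.exp_add, ← Real.exp_add] at h2
      rw [abs_of_nonpos (sub_nonpos.2 h)]
      rwa [show (M + 1) * b + -(M + 1) * b = 0 by ring, Real.exp_zero, one_mul,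
        show (M + 1) * b + -(M + 1) * a = (M + 1) * -(a - b) by ring] at h2
    · have h1 : Real.exp ((M + 1) * b) * (φ b + Φ) ≤ Real.exp ((M + 1) * a) * (φ a + Φ) :=
        hmono hb ha h
      have h2 := mul_le_mul_of_nonneg_left h1 (Real.exp_pos (-(M + 1) * b)).le
      rw [← mul_assoc, ← mul_assoc, ← Real.exp_add, ← Real.exp_add] at h2
      rw [abs_of_nonneg (sub_nonneg.2 h)]
      rwa [show -(M + 1) * b + (M + 1) * b = 0 by ring, Real.exp_zero, one_mul,
        show -(M + 1) * b + (M + 1) * a = (M + 1) * (a - b) by ring] at h2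
  have h3 : Real.exp ((M + 1) * |a - b|) ≤ Real.exp ((M + 1) * R) :=
    Real.exp_le_exp.2 (mul_le_mul_of_nonneg_left hab (by linarith))
  have := mul_le_mul_of_nonneg_right h3 (hψ a ha)
  linarith

theorem bottomError_le {Φ M : ℝ} (hΦ : 0 ≤ Φ) (hM : 0 ≤ M) (h0 : ∀ a, 0 ≤ a → 0 ≤ φ a)
    (hd : DifferentiableOn ℝ φ (Ici 0))
    (hg : ∀ a, 0 ≤ a → |derivWithin φ (Ici 0) a| ≤ Φ + M * φ a) {a ε : ℝ} (ha : 0 ≤ a)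
    (hε : 0 ≤ ε) (hε1 : ε ≤ 1) :
    bottomError φ ε a ≤ 3 * (Φ + M * (Real.exp (M + 1) * (φ a + Φ))) := by
  have hb : ∀ b, 0 ≤ b → |a - b| ≤ 1 →
      |derivWithin φ (Ici 0) b| ≤ Φ + M * (Real.exp (M + 1) * (φ a + Φ)) := fun b hb hab => by
    have h := gronwall_bound hΦ hM h0 hd hg ha hb hab
    rw [mul_one] at h
    exact (hg b hb).trans (by gcongr)
  have hnn : 0 ≤ Φ + M * (Real.exp (M + 1) * (φ a + Φ)) := by
    have := h0 a ha
    positivity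
  unfold bottomError
  split_ifs with h1 h2
  · subst h1
    have e1 := hb 0 le_rfl (by simp)
    have e2 := hb ε hε (by rw [zero_sub, abs_neg, abs_of_nonneg hε]; exact hε1)
    have := abs_sub (derivWithin φ (Ici 0) ε) (derivWithin φ (Ici 0) 0)
    linarith
  · have e1 := hb 0 le_rfl (by rw [sub_zero, abs_of_nonneg ha]; linarith)
    have e2 := hb ε hε (by rw [abs_le]; constructor <;> linarith)
    linarith
  · linarith

theorem tendsto_bottomError (hφ : ContDiffOn ℝ 1 φ (Ici 0)) {a : ℝ} (ha : 0 ≤ a) :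
    Tendsto (fun ε => bottomError φ ε a) (𝓝[>] 0) (𝓝 0) := by
  rcases ha.eq_or_lt with rfl | ha'
  · have h1 := (hφ.continuousOn_derivWithin (uniqueDiffOn_Ici 0) le_rfl) 0 self_mem_Ici
    have h2 : Tendsto (derivWithin φ (Ici 0)) (𝓝[>] 0) (𝓝 (derivWithin φ (Ici 0) 0)) :=
      h1.tendsto.mono_left (nhdsWithin_mono _ Ioi_subset_Ici_self)
    simpa [bottomError] using (h2.sub_const (derivWithin φ (Ici 0) 0)).abs
  · refine tendsto_const_nhds.congr' ?_
    filter_upwards [nhdsWithin_le_nhds (Iio_mem_nhds ha')] with ε hε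
    rw [bottomError, if_neg ha'.ne', if_neg (not_lt.2 (le_of_lt hε))]

end Scalar

section Measurability

variable {E : Type*} [MeasurableSpace E] {φ : E → ℝ → ℝ}

theorem measurable_eval_of_nonneg (hm : Measurable fun p : E × Ici (0 : ℝ) => φ p.1 p.2) {α : Type*}
    [MeasurableSpace α] {l : α → E} {a : α → ℝ} (hl : Measurable l) (ha : Measurable a)
    (h0 : ∀ x, 0 ≤ a x) : Measurable fun x => φ (l x) (a x) :=
  hm.comp (hl.prodMk (ha.subtype_mk (h := h0)))

theorem measurable_derivA (hm : Measurable fun p : E × Ici (0 : ℝ) => φ p.1 p.2)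
    (hd : ∀ l, DifferentiableOn ℝ (φ l) (Ici 0)) {a : ℝ} (ha : 0 ≤ a) :
    Measurable fun l => derivA φ l a := by
  have hpos : ∀ n : ℕ, (0 : ℝ) < 1 / ((n : ℝ) + 1) := fun n => by positivity
  refine measurable_of_tendsto_metrizable (f := fun (n : ℕ) (l : E) =>
    slope (φ l) a (a + 1 / ((n : ℝ) + 1))) (fun n => ?_) ?_
  · simp only [slope_def_field]
    refine Measurable.div_const (Measurable.sub ?_ ?_) _
    · exact measurable_eval_of_nonneg hm measurable_id measurable_const
        (fun _ => add_nonneg ha (hpos n).le)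
    · exact measurable_eval_of_nonneg hm measurable_id measurable_const (fun _ => ha)
  · rw [tendsto_pi_nhds]
    intro l
    have h := hasDerivWithinAt_iff_tendsto_slope.1 ((hd l) a ha).hasDerivWithinAt
    refine h.comp (tendsto_nhdsWithin_iff.2 ⟨?_, Eventually.of_forall fun n => ⟨?_, ?_⟩⟩)
    · simpa using tendsto_const_nhds.add (tendsto_one_div_add_atTop_nhds_zero_nat (𝕜 := ℝ))
    · exact add_nonneg ha (hpos n).le
    · simpa using (hpos n).ne'

theorem measurable_bottomError (hm : Measurable fun p : E × Ici (0 : ℝ) => φ p.1 p.2)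
    (hd : ∀ l, DifferentiableOn ℝ (φ l) (Ici 0)) {ε : ℝ} (hε : 0 ≤ ε) :
    Measurable fun p : E × ℝ => bottomError (φ p.1) ε p.2 := by
  have h0 : Measurable fun p : E × ℝ => derivA φ p.1 0 :=
    (measurable_derivA hm hd le_rfl).comp measurable_fst
  have h1 : Measurable fun p : E × ℝ => derivA φ p.1 ε :=
    (measurable_derivA hm hd hε).comp measurable_fst
  unfold bottomError
  refine Measurable.ite (measurableSet_eq_fun measurable_snd measurable_const)
    (h1.sub h0).abs (Measurable.ite (measurableSet_lt measurable_snd measurable_const) ?_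
      measurable_const)
  exact h1.abs.add (h0.abs.const_mul 2)

end Measurability

section Pathwise

variable {d : ℕ} {T : ℝ} [hT : Fact (0 < T)]

namespace CostIngredients

/-- The cost per unit of control, frozen outside of `[0,T]`. -/
def fExt (c : CostIngredients d T) (t : ℝ) : ℝ := IccExtend hT.out.le (domRestrict (Icc 0 T) c.f) t

theorem continuous_fExt (c : CostIngredients d T) : Continuous c.fExt :=
  (continuousOn_iff_continuous_domRestrict.1 c.f_cont).Icc_extend'

theorem fExt_of_mem (c : CostIngredients d T) {t : ℝ} (ht : t ∈ Icc 0 T) : c.fExt t = c.f t :=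
  IccExtend_of_mem _ _ ht

theorem exists_fExt_le (c : CostIngredients d T) : ∃ C, ∀ t, c.fExt t ≤ C := by
  obtain ⟨C, hC⟩ := isCompact_Icc.bddAbove_image c.f_cont
  exact ⟨C, fun t => hC ⟨_, (projIcc 0 T hT.out.le t).2, rfl⟩⟩

/-- The part of the cost that is proportional to the control. -/
def controlCost (c : CostIngredients d T) (A : IncreasingPath T) : ℝ≥0∞ :=
  ∫⁻ t in Icc 0 T, ENNReal.ofReal (c.f t) ∂A.stieltjes.measure

theorem controlCost_eq (c : CostIngredients d T) (A : IncreasingPath T) :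
    c.controlCost A
      = ∫⁻ t, (Icc 0 T).indicator (fun t => ENNReal.ofReal (c.fExt t)) t ∂A.stieltjes.measure := by
  rw [lintegral_indicator measurableSet_Icc]
  refine setLIntegral_congr_fun measurableSet_Icc fun t ht => ?_
  rw [c.fExt_of_mem ht]

theorem measurable_fExt_indicator (c : CostIngredients d T) :
    Measurable ((Icc 0 T).indicator fun t => ENNReal.ofReal (c.fExt t)) :=
  c.continuous_fExt.measurable.ennreal_ofReal.indicator measurableSet_Icc

theorem measurable_controlCost (c : CostIngredients d T) : Measurable c.controlCost := by
  simp only [funext c.controlCost_eq]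
  exact (Measure.measurable_lintegral c.measurable_fExt_indicator).comp measurable_stieltjes

/-- The nonnegative terms of the stopping cost at time `s`. -/
def stopPos (c : CostIngredients d T) (L : CadlagPath T (EuclideanSpace ℝ (Fin d))) (s : ℝ) :
    ℝ≥0∞ :=
  (if s ≤ T then ENNReal.ofReal (c.fExt s) else 0)
    + (if s ≤ T then ENNReal.ofReal (derivA c.g (L T) 0) else 0)
    + ∫⁻ t in Icc 0 T, if s ≤ t then ENNReal.ofReal (derivA c.h (L t) 0) else 0

/-- The negative terms of the stopping cost at time `s`, in absolute value. -/
def stopNeg (c : CostIngredients d T) (L : CadlagPath T (EuclideanSpace ℝ (Fin d))) (s : ℝ) :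
    ℝ≥0∞ :=
  (if s ≤ T then ENNReal.ofReal (-derivA c.g (L T) 0) else 0)
    + ∫⁻ t in Icc 0 T, if s ≤ t then ENNReal.ofReal (-derivA c.h (L t) 0) else 0

/-- The error, relative to `ε`, made when the control cost of the bottom part of height `ε` is
replaced by the cost of a jump at the start time. -/
def controlError (c : CostIngredients d T) (ε : ℝ≥0) (A : IncreasingPath T) : ℝ≥0∞ :=
  (if startTime A ≤ T then ENNReal.ofReal (c.fExt (startTime A)) else 0)
    - (ε : ℝ≥0∞)⁻¹ * c.controlCost (A.bottom ε)

/-- The total first-order error of the replacement of the bottom part of height `ε`. -/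
def replaceError (c : CostIngredients d T) (ε : ℝ≥0) (ω : PathPair d T) : ℝ≥0∞ :=
  c.controlError ε ω.2 + ENNReal.ofReal (bottomError (c.g (ω.1 T)) ε (ω.2 T))
    + ∫⁻ t in Icc 0 T, ENNReal.ofReal (bottomError (c.h (ω.1 t)) ε (ω.2 t))

theorem controlCost_replaceBottom (c : CostIngredients d T) (A : IncreasingPath T) (ε : ℝ≥0)
    {s : ℝ} (hs : s ∈ Icc 0 T ∨ s = T + 1) :
    c.controlCost (A.replaceBottom ε s) + c.controlCost (A.bottom ε)
      = c.controlCost A + ε * (if s ≤ T then ENNReal.ofReal (c.fExt s) else 0) := by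
  rw [controlCost_eq, controlCost_eq, controlCost_eq, ← lintegral_add_measure]
  rcases hs with hs | rfl
  · rw [A.stieltjes_replaceBottom ε hs, lintegral_add_measure, lintegral_smul_measure,
      lintegral_dirac' _ c.measurable_fExt_indicator, indicator_of_mem hs, if_pos hs.2, smul_eq_mul]
  · rw [A.stieltjes_replaceBottom_of_gt ε (by linarith), if_neg (by linarith), mul_zero, add_zero]

theorem controlCost_replaceBottom_le (c : CostIngredients d T) (A : IncreasingPath T) {ε : ℝ≥0}
    (hε : 0 < ε) {s : ℝ} (hs : s ∈ Icc 0 T ∨ s = T + 1) :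
    c.controlCost (A.replaceBottom ε s)
        + ε * (if startTime A ≤ T then ENNReal.ofReal (c.fExt (startTime A)) else 0)
      ≤ c.controlCost A + ε * (if s ≤ T then ENNReal.ofReal (c.fExt s) else 0)
        + ε * c.controlError ε A := by
  rw [← c.controlCost_replaceBottom A ε hs, add_assoc]
  refine add_le_add le_rfl ?_
  have h : (if startTime A ≤ T then ENNReal.ofReal (c.fExt (startTime A)) else 0)
      ≤ (ε : ℝ≥0∞)⁻¹ * c.controlCost (A.bottom ε) + c.controlError ε A := le_add_tsub
  have hne : (ε : ℝ≥0∞) ≠ 0 := by exact_mod_cast hε.ne'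
  calc _ ≤ (ε : ℝ≥0∞) * ((ε : ℝ≥0∞)⁻¹ * c.controlCost (A.bottom ε) + c.controlError ε A) := by
        gcongr
    _ = _ := by
        rw [mul_add, ← mul_assoc, ENNReal.mul_inv_cancel hne ENNReal.coe_ne_top, one_mul]

variable {c : CostIngredients d T}

theorem measurable_derivA_path (hh : ∀ l, ContDiffOn ℝ 1 (c.h l) (Ici 0)) :
    Measurable fun p : CadlagPath T (EuclideanSpace ℝ (Fin d)) × ℝ => derivA c.h (p.1 p.2) 0 :=
  (measurable_derivA c.h_meas (fun l => (hh l).differentiableOn one_ne_zero) le_rfl).comp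
    measurable_eval_uncurry

theorem measurable_runningCost :
    Measurable fun p : PathPair d T × ℝ => c.h (p.1.1 p.2) (p.1.2 p.2) :=
  measurable_eval_of_nonneg c.h_meas
    (measurable_eval_uncurry.comp ((measurable_fst.comp measurable_fst).prodMk measurable_snd))
    (measurable_increasing_eval_uncurry.comp
      ((measurable_snd.comp measurable_fst).prodMk measurable_snd))
    (fun p => p.1.2.eval_nonneg _)

theorem measurable_cost : Measurable c.cost := by
  refine Measurable.add (Measurable.add ?_ ?_) ?_
  · exact c.measurable_controlCost.comp measurable_snd
  · exact (measurable_runningCost (c := c)).ennreal_ofReal.lintegral_prod_right'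
  · refine Measurable.ennreal_ofReal ?_
    exact measurable_eval_of_nonneg c.g_meas ((measurable_eval T).comp measurable_fst)
      ((measurable_increasing_eval T).comp measurable_snd) (fun ω => ω.2.eval_nonneg _)

theorem measurable_stopPos (hg : ∀ l, ContDiffOn ℝ 1 (c.g l) (Ici 0))
    (hh : ∀ l, ContDiffOn ℝ 1 (c.h l) (Ici 0)) :
    Measurable fun p : CadlagPath T (EuclideanSpace ℝ (Fin d)) × ℝ => c.stopPos p.1 p.2 := by
  have hs : MeasurableSet {p : CadlagPath T (EuclideanSpace ℝ (Fin d)) × ℝ | p.2 ≤ T} :=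
    measurableSet_le measurable_snd measurable_const
  refine Measurable.add (Measurable.add ?_ ?_) ?_
  · exact Measurable.ite hs (c.continuous_fExt.measurable.comp measurable_snd).ennreal_ofReal
      measurable_const
  · refine Measurable.ite hs (Measurable.ennreal_ofReal ?_) measurable_const
    exact (measurable_derivA c.g_meas (fun l => (hg l).differentiableOn one_ne_zero) le_rfl).comp
      ((measurable_eval T).comp measurable_fst)
  · refine Measurable.lintegral_prod_right' (f := fun q : (CadlagPath T (EuclideanSpace ℝ (Fin d))
      × ℝ) × ℝ => if q.1.2 ≤ q.2 then ENNReal.ofReal (derivA c.h (q.1.1 q.2) 0) else 0) ?_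
    refine Measurable.ite (measurableSet_le (measurable_snd.comp measurable_fst) measurable_snd)
      (Measurable.ennreal_ofReal ?_) measurable_const
    exact (measurable_derivA_path hh).comp ((measurable_fst.comp measurable_fst).prodMk
      measurable_snd)

theorem measurable_stopNeg (hg : ∀ l, ContDiffOn ℝ 1 (c.g l) (Ici 0))
    (hh : ∀ l, ContDiffOn ℝ 1 (c.h l) (Ici 0)) :
    Measurable fun p : CadlagPath T (EuclideanSpace ℝ (Fin d)) × ℝ => c.stopNeg p.1 p.2 := by
  have hs : MeasurableSet {p : CadlagPath T (EuclideanSpace ℝ (Fin d)) × ℝ | p.2 ≤ T} :=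
    measurableSet_le measurable_snd measurable_const
  refine Measurable.add ?_ ?_
  · refine Measurable.ite hs (Measurable.ennreal_ofReal (Measurable.neg ?_)) measurable_const
    exact (measurable_derivA c.g_meas (fun l => (hg l).differentiableOn one_ne_zero) le_rfl).comp
      ((measurable_eval T).comp measurable_fst)
  · refine Measurable.lintegral_prod_right' (f := fun q : (CadlagPath T (EuclideanSpace ℝ (Fin d))
      × ℝ) × ℝ => if q.1.2 ≤ q.2 then ENNReal.ofReal (-derivA c.h (q.1.1 q.2) 0) else 0) ?_
    refine Measurable.ite (measurableSet_le (measurable_snd.comp measurable_fst) measurable_snd)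
      (Measurable.ennreal_ofReal (Measurable.neg ?_)) measurable_const
    exact (measurable_derivA_path hh).comp ((measurable_fst.comp measurable_fst).prodMk
      measurable_snd)

theorem measurable_bottomError_path (hh : ∀ l, ContDiffOn ℝ 1 (c.h l) (Ici 0)) (ε : ℝ≥0) :
    Measurable fun p : PathPair d T × ℝ => bottomError (c.h (p.1.1 p.2)) ε (p.1.2 p.2) :=
  (measurable_bottomError c.h_meas (fun l => (hh l).differentiableOn one_ne_zero) ε.2).comp
    ((measurable_eval_uncurry.comp ((measurable_fst.comp measurable_fst).prodMk
      measurable_snd)).prodMk (measurable_increasing_eval_uncurry.comp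
      ((measurable_snd.comp measurable_fst).prodMk measurable_snd)))

theorem measurable_bottomError_terminal (hg : ∀ l, ContDiffOn ℝ 1 (c.g l) (Ici 0)) (ε : ℝ≥0) :
    Measurable fun ω : PathPair d T => bottomError (c.g (ω.1 T)) ε (ω.2 T) :=
  (measurable_bottomError c.g_meas (fun l => (hg l).differentiableOn one_ne_zero) ε.2).comp
    (((measurable_eval T).comp measurable_fst).prodMk
      ((measurable_increasing_eval T).comp measurable_snd))

theorem measurable_controlError (ε : ℝ≥0) :
    Measurable fun ω : PathPair d T => c.controlError ε ω.2 := by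
  refine Measurable.sub (Measurable.ite
    (measurableSet_le measurable_startTime_snd measurable_const) ?_ measurable_const) ?_
  · exact (c.continuous_fExt.measurable.comp measurable_startTime_snd).ennreal_ofReal
  · exact ((c.measurable_controlCost.comp (measurable_bottom ε)).comp measurable_snd).const_mul _

theorem runningCost_replaceBottom_le (hh : ∀ l, ContDiffOn ℝ 1 (c.h l) (Ici 0))
    (ω : PathPair d T) (ε : ℝ≥0) (s : ℝ) :
    (∫⁻ t in Icc 0 T, ENNReal.ofReal (c.h (ω.1 t) (ω.2.replaceBottom ε s t)))
        + ε * (∫⁻ t in Icc 0 T, if startTime ω.2 ≤ t then ENNReal.ofReal (derivA c.h (ω.1 t) 0)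
            else 0)
        + ε * (∫⁻ t in Icc 0 T, if s ≤ t then ENNReal.ofReal (-derivA c.h (ω.1 t) 0) else 0)
      ≤ (∫⁻ t in Icc 0 T, ENNReal.ofReal (c.h (ω.1 t) (ω.2 t)))
        + ε * (∫⁻ t in Icc 0 T, if s ≤ t then ENNReal.ofReal (derivA c.h (ω.1 t) 0) else 0)
        + ε * (∫⁻ t in Icc 0 T, if startTime ω.2 ≤ t then ENNReal.ofReal (-derivA c.h (ω.1 t) 0)
            else 0)
        + ε * ∫⁻ t in Icc 0 T, ENNReal.ofReal (bottomError (c.h (ω.1 t)) ε (ω.2 t)) := by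
  have hD : Measurable fun t => derivA c.h (ω.1 t) 0 :=
    (measurable_derivA_path hh).comp measurable_prodMk_left
  have hi : ∀ r, Measurable fun t => if r ≤ t then ENNReal.ofReal (derivA c.h (ω.1 t) 0) else 0 :=
    fun r => Measurable.ite (measurableSet_le measurable_const measurable_id) hD.ennreal_ofReal
      measurable_const
  have hi' : ∀ r, Measurable fun t =>
      if r ≤ t then ENNReal.ofReal (-derivA c.h (ω.1 t) 0) else 0 :=
    fun r => Measurable.ite (measurableSet_le measurable_const measurable_id)
      hD.neg.ennreal_ofReal measurable_const
  have he : Measurable fun t => ENNReal.ofReal (bottomError (c.h (ω.1 t)) ε (ω.2 t)) :=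
    ((measurable_bottomError_path hh ε).comp measurable_prodMk_left).ennreal_ofReal
  rw [← lintegral_const_mul _ (hi _), ← lintegral_const_mul _ (hi _),
    ← lintegral_const_mul _ (hi' _), ← lintegral_const_mul _ (hi' _), ← lintegral_const_mul _ he,
    ← lintegral_add_right _ ((hi _).const_mul _), ← lintegral_add_right _ ((hi' _).const_mul _),
    ← lintegral_add_right _ ((hi _).const_mul _), ← lintegral_add_right _ ((hi' _).const_mul _),
    ← lintegral_add_right _ (he.const_mul _)]
  refine lintegral_mono_ae ?_
  have hne : ∀ᵐ t ∂(volume.restrict (Icc 0 T)), t ≠ startTime ω.2 :=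
    ae_restrict_of_ae (Measure.ae_ne volume _)
  filter_upwards [hne, ae_restrict_mem measurableSet_Icc] with t ht htI
  have hiff : startTime ω.2 ≤ t ↔ 0 < ω.2 t :=
    ⟨fun h => pos_of_startTime_lt htI.2 (lt_of_le_of_ne h ht.symm), startTime_le_of_pos htI⟩
  rw [IncreasingPath.replaceBottom_eval _ _ _ htI]
  simp only [hiff]
  exact replaceBottom_ofReal (c.h_nonneg _) (c.h_convex _) ((hh _).differentiableOn one_ne_zero) ε
    (ω.2.eval_nonneg t) (s ≤ t)

/-- The first-order effect on the cost of replacing the bottom part of a control by a jump. -/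
theorem cost_replaceMap_le (hg : ∀ l, ContDiffOn ℝ 1 (c.g l) (Ici 0))
    (hh : ∀ l, ContDiffOn ℝ 1 (c.h l) (Ici 0)) (ω : PathPair d T) {ε : ℝ≥0} (hε : 0 < ε) {s : ℝ}
    (hs : s ∈ Icc 0 T ∨ s = T + 1) :
    c.cost (replaceMap ε (ω, s)) + ε * (c.stopPos ω.1 (startTime ω.2) + c.stopNeg ω.1 s)
      ≤ c.cost ω + ε * (c.stopPos ω.1 s + c.stopNeg ω.1 (startTime ω.2) + c.replaceError ε ω) := by
  have h1 := c.controlCost_replaceBottom_le ω.2 hε hs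
  have h2 := runningCost_replaceBottom_le hh ω ε s
  have h3 := replaceBottom_ofReal (c.g_nonneg (ω.1 T)) (c.g_convex (ω.1 T))
    ((hg _).differentiableOn one_ne_zero) ε (ω.2.eval_nonneg T) (s ≤ T)
  rw [← IncreasingPath.replaceBottom_eval _ _ _ ⟨hT.out.le, le_rfl⟩] at h3
  simp only [← startTime_le_iff_pos] at h3
  have h := add_le_add (add_le_add h1 h2) h3
  refine le_trans (le_of_eq ?_) (h.trans (le_of_eq ?_))
  · simp only [cost, stopPos, stopNeg, replaceMap, controlCost, derivA]
    ring
  · simp only [cost, stopPos, stopNeg, replaceError, controlCost, derivA]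
    ring

end CostIngredients

end Pathwise

section StoppingCost

variable {d : ℕ} {T : ℝ} [hT : Fact (0 < T)] {c : CostIngredients d T}

namespace CostIngredients

theorem stoppingCost_eq (c : CostIngredients d T) (ω : PathPair d T) :
    c.stoppingCost ω = if startTime ω.2 ≤ T then c.fExt (startTime ω.2) + derivA c.g (ω.1 T) 0
      + ∫ t in Icc 0 T, (if startTime ω.2 ≤ t then derivA c.h (ω.1 t) 0 else 0) else 0 := by
  unfold stoppingCost
  by_cases h : 0 < ω.2 T
  · rw [if_neg (by rw [firstPositive_eq_top_iff]; exact not_not.2 h), firstPositive_of_pos h,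
      EReal.toReal_coe, if_pos (startTime_le_iff_pos.2 h), c.fExt_of_mem (startTime_mem h),
      intervalIntegral.integral_of_le (startTime_mem h).2, ← integral_Icc_eq_integral_Ioc]
    congr 1
    have h1 : (fun t => if startTime ω.2 ≤ t then derivA c.h (ω.1 t) 0 else 0)
        = (Ici (startTime ω.2)).indicator fun t => derivA c.h (ω.1 t) 0 := by
      funext t
      simp [indicator]
    rw [h1, setIntegral_indicator measurableSet_Ici]
    congr 2
    ext t
    simp only [mem_Icc, mem_inter_iff, mem_Ici]
    exact ⟨fun h2 => ⟨⟨(startTime_mem h).1.trans h2.1, h2.2⟩, h2.1⟩, fun h2 => ⟨h2.2, h2.1.2⟩⟩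
  · rw [if_pos (firstPositive_eq_top_iff.2 h), if_neg (fun h' => h (startTime_le_iff_pos.1 h'))]

theorem measurable_stoppingCost (hg : ∀ l, ContDiffOn ℝ 1 (c.g l) (Ici 0))
    (hh : ∀ l, ContDiffOn ℝ 1 (c.h l) (Ici 0)) : Measurable c.stoppingCost := by
  simp only [funext c.stoppingCost_eq]
  refine Measurable.ite (measurableSet_le measurable_startTime_snd measurable_const)
    (Measurable.add (Measurable.add ?_ ?_) ?_) measurable_const
  · exact c.continuous_fExt.measurable.comp measurable_startTime_snd
  · exact (measurable_derivA c.g_meas (fun l => (hg l).differentiableOn one_ne_zero) le_rfl).comp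
      ((measurable_eval T).comp measurable_fst)
  · refine (StronglyMeasurable.integral_prod_right' (f := fun q : PathPair d T × ℝ =>
      if startTime q.1.2 ≤ q.2 then derivA c.h (q.1.1 q.2) 0 else 0) ?_).measurable
    refine (Measurable.ite (measurableSet_le (measurable_startTime_snd.comp measurable_fst)
      measurable_snd) ?_ measurable_const).stronglyMeasurable
    exact (measurable_derivA_path hh).comp
      ((measurable_fst.comp measurable_fst).prodMk measurable_snd)

theorem ofReal_add_eq_ofReal_neg_add {a b x : ℝ≥0∞} {z : ℝ} (ha : a ≠ ∞) (hb : b ≠ ∞)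
    (hx : x ≠ ∞) (h : z = a.toReal + x.toReal - b.toReal) :
    ENNReal.ofReal z + b = a + x + ENNReal.ofReal (-z) := by
  lift a to ℝ≥0 using ha
  lift b to ℝ≥0 using hb
  lift x to ℝ≥0 using hx
  simp only [ENNReal.coe_toReal] at h
  have h0 : max z 0 = z + max (-z) 0 := by
    rcases le_total z 0 with h | h <;> simp [h]
  simp only [ENNReal.ofReal]
  norm_cast
  rw [← NNReal.coe_inj]
  push_cast [Real.coe_toNNReal']
  rw [h0, h]
  ring

theorem stoppingCost_parts {ω : PathPair d T}
    (hint : IntegrableOn (fun t => derivA c.h (ω.1 t) 0) (Icc 0 T)) :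
    ENNReal.ofReal (c.stoppingCost ω) + c.stopNeg ω.1 (startTime ω.2)
      = c.stopPos ω.1 (startTime ω.2) + ENNReal.ofReal (-c.stoppingCost ω) := by
  rw [stoppingCost_eq]
  by_cases h : startTime ω.2 ≤ T
  · have hi : Integrable (fun t => if startTime ω.2 ≤ t then derivA c.h (ω.1 t) 0 else 0)
        (volume.restrict (Icc 0 T)) := by
      have := hint.integrable.indicator (measurableSet_Ici (a := startTime ω.2))
      refine this.congr (Eventually.of_forall fun t => ?_)
      simp [indicator]
    have hp : (∫⁻ t in Icc 0 T, if startTime ω.2 ≤ t then ENNReal.ofReal (derivA c.h (ω.1 t) 0)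
        else 0) = ∫⁻ t in Icc 0 T, ENNReal.ofReal
          (if startTime ω.2 ≤ t then derivA c.h (ω.1 t) 0 else 0) :=
      lintegral_congr fun t => by split_ifs <;> simp
    have hn : (∫⁻ t in Icc 0 T, if startTime ω.2 ≤ t then ENNReal.ofReal (-derivA c.h (ω.1 t) 0)
        else 0) = ∫⁻ t in Icc 0 T, ENNReal.ofReal
          (-if startTime ω.2 ≤ t then derivA c.h (ω.1 t) 0 else 0) :=
      lintegral_congr fun t => by split_ifs <;> simp
    simp only [stopPos, stopNeg, if_pos h, hp, hn]
    have hpf : ∫⁻ t in Icc 0 T, ENNReal.ofReal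
        (if startTime ω.2 ≤ t then derivA c.h (ω.1 t) 0 else 0) ≠ ∞ :=
      (hi.lintegral_lt_top).ne
    have hnf : ∫⁻ t in Icc 0 T, ENNReal.ofReal
        (-if startTime ω.2 ≤ t then derivA c.h (ω.1 t) 0 else 0) ≠ ∞ :=
      (hi.neg.lintegral_lt_top).ne
    refine ofReal_add_eq_ofReal_neg_add (by simp) (by simp [hnf]) hpf ?_
    rw [integral_eq_lintegral_pos_part_sub_lintegral_neg_part hi,
      ENNReal.toReal_add (by simp) (by simp), ENNReal.toReal_add (by simp) hnf]
    have hf : 0 ≤ c.fExt (startTime ω.2) := by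
      have hm := startTime_mem (startTime_le_iff_pos.1 h)
      rw [c.fExt_of_mem hm]
      exact c.f_nonneg _ hm
    have hgd : derivA c.g (ω.1 T) 0 = (ENNReal.ofReal (derivA c.g (ω.1 T) 0)).toReal
        - (ENNReal.ofReal (-derivA c.g (ω.1 T) 0)).toReal := by
      rw [ENNReal.toReal_ofReal', ENNReal.toReal_ofReal']
      rcases le_total (derivA c.g (ω.1 T) 0) 0 with h | h <;> simp [h]
    rw [ENNReal.toReal_ofReal hf]
    linarith
  · have hz : ∀ F : ℝ → ℝ≥0∞, (∫⁻ t in Icc 0 T, if startTime ω.2 ≤ t then F t else 0) = 0 := by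
      intro F
      rw [setLIntegral_congr_fun (g := fun _ => 0) measurableSet_Icc fun t ht =>
        if_neg fun h' => h (h'.trans ht.2), lintegral_zero]
    simp [stopPos, stopNeg, if_neg h, hz]

end CostIngredients

end StoppingCost

theorem integrableOn_of_lintegral_lt_top {T : ℝ} {u : ℝ → ℝ} (hu : Measurable u) (h0 : ∀ t, 0 ≤ u t)
    (h : ∫⁻ t in Icc 0 T, ENNReal.ofReal (u t) < ∞) : IntegrableOn u (Icc 0 T) :=
  ⟨hu.aestronglyMeasurable, (hasFiniteIntegral_iff_ofReal (Eventually.of_forall h0)).2 h⟩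

section Integrability

variable {d : ℕ} {T : ℝ} [hT : Fact (0 < T)] {c : CostIngredients d T}
  {Φg Φh : EuclideanSpace ℝ (Fin d) → ℝ} {M : ℝ}

namespace CostIngredients

theorem integrableOn_derivA (hh : ∀ l, ContDiffOn ℝ 1 (c.h l) (Ici 0)) (hΦh : Measurable Φh)
    (hΦh0 : ∀ l, 0 ≤ Φh l) (hM : 0 ≤ M)
    (hgrowth_h : ∀ l, ∀ a, 0 ≤ a → |derivA c.h l a| ≤ Φh l + M * c.h l a) {ω : PathPair d T}
    (h1 : ∫⁻ t in Icc 0 T, ENNReal.ofReal (c.h (ω.1 t) (ω.2 t)) < ∞)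
    (h2 : ∫⁻ t in Icc 0 T, ENNReal.ofReal (Φh (ω.1 t)) < ∞) :
    IntegrableOn (fun t => derivA c.h (ω.1 t) 0) (Icc 0 T) := by
  have i1 : IntegrableOn (fun t => c.h (ω.1 t) (ω.2 t)) (Icc 0 T) :=
    integrableOn_of_lintegral_lt_top (measurable_runningCost.comp measurable_prodMk_left)
      (fun t => c.h_nonneg _ _ (ω.2.eval_nonneg t)) h1
  have i2 : IntegrableOn (fun t => Φh (ω.1 t)) (Icc 0 T) :=
    integrableOn_of_lintegral_lt_top
      (hΦh.comp (measurable_eval_uncurry.comp measurable_prodMk_left)) (fun t => hΦh0 _) h2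
  have hmeas : Measurable fun t => derivA c.h (ω.1 t) 0 :=
    (measurable_derivA_path hh).comp measurable_prodMk_left
  refine Integrable.mono' (i2.add (((i1.add i2).const_mul
    (Real.exp ((M + 1) * ω.2 T))).const_mul M)) hmeas.aestronglyMeasurable
    (Eventually.of_forall fun t => ?_)
  have hb := gronwall_bound (hΦh0 (ω.1 t)) hM (c.h_nonneg _) ((hh _).differentiableOn one_ne_zero)
    (hgrowth_h (ω.1 t)) (ω.2.eval_nonneg t) le_rfl (R := ω.2 T)
    (by rw [sub_zero, abs_of_nonneg (ω.2.eval_nonneg t)]; exact ω.2.eval_le t)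
  exact (hgrowth_h _ 0 le_rfl).trans (add_le_add le_rfl (mul_le_mul_of_nonneg_left hb hM))

theorem ofReal_derivWithin_zero_le {φ : ℝ → ℝ} {Φ : ℝ} (hΦ : 0 ≤ Φ) (hM : 0 ≤ M)
    (h0 : ∀ a, 0 ≤ a → 0 ≤ φ a) (hc : ConvexOn ℝ (Ici 0) φ) (hd : DifferentiableOn ℝ φ (Ici 0))
    (hg : ∀ a, 0 ≤ a → |derivWithin φ (Ici 0) a| ≤ Φ + M * φ a) {a : ℝ} (ha : 0 ≤ a) :
    ENNReal.ofReal (derivWithin φ (Ici 0) 0)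
      ≤ ENNReal.ofReal Φ + ENNReal.ofReal M * ENNReal.ofReal (φ a) := by
  rw [← ENNReal.ofReal_mul hM, ← ENNReal.ofReal_add hΦ (mul_nonneg hM (h0 a ha))]
  exact ENNReal.ofReal_le_ofReal
    ((derivWithin_zero_le hc hd ha).trans ((le_abs_self _).trans (hg a ha)))

variable {P₀ : Measure (CadlagPath T (EuclideanSpace ℝ (Fin d)))} {P P' : Measure (PathPair d T)}

theorem ae_integrableOn_derivA (hh : ∀ l, ContDiffOn ℝ 1 (c.h l) (Ici 0)) (hΦh : Measurable Φh)
    (hΦh0 : ∀ l, 0 ≤ Φh l) (hM : 0 ≤ M)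
    (hΦ : ∫⁻ L : CadlagPath T (EuclideanSpace ℝ (Fin d)),
      ((∫⁻ t in Icc 0 T, ENNReal.ofReal (Φh (L t))) + ENNReal.ofReal (Φg (L T))) ∂P₀ < ∞)
    (hΦg : Measurable Φg)
    (hgrowth_h : ∀ l, ∀ a, 0 ≤ a → |derivA c.h l a| ≤ Φh l + M * c.h l a)
    (hP : P.map Prod.fst = P₀) (hJ : c.J P < ∞) :
    ∀ᵐ L ∂P₀, IntegrableOn (fun t => derivA c.h (L t) 0) (Icc 0 T) := by
  have hΦm : Measurable fun L : CadlagPath T (EuclideanSpace ℝ (Fin d)) =>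
      ∫⁻ t in Icc 0 T, ENNReal.ofReal (Φh (L t)) :=
    (hΦh.comp measurable_eval_uncurry).ennreal_ofReal.lintegral_prod_right'
  have hΦm' : Measurable fun L : CadlagPath T (EuclideanSpace ℝ (Fin d)) =>
      (∫⁻ t in Icc 0 T, ENNReal.ofReal (Φh (L t))) + ENNReal.ofReal (Φg (L T)) :=
    hΦm.add (hΦg.comp (measurable_eval T)).ennreal_ofReal
  have hmeas : Measurable fun L : CadlagPath T (EuclideanSpace ℝ (Fin d)) =>
      ∫⁻ t in Icc 0 T, ‖derivA c.h (L t) 0‖ₑ :=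
    (measurable_derivA_path hh).enorm.lintegral_prod_right'
  have hiff : ∀ L : CadlagPath T (EuclideanSpace ℝ (Fin d)),
      IntegrableOn (fun t => derivA c.h (L t) 0) (Icc 0 T)
        ↔ ∫⁻ t in Icc 0 T, ‖derivA c.h (L t) 0‖ₑ < ∞ := fun L =>
    ⟨fun h => h.2, fun h =>
      ⟨((measurable_derivA_path hh).comp measurable_prodMk_left).aestronglyMeasurable, h⟩⟩
  simp only [hiff]
  rw [← hP, ae_map_iff measurable_fst.aemeasurable (measurableSet_lt hmeas measurable_const)]
  have e1 : ∀ᵐ ω ∂P, c.cost ω < ∞ := ae_lt_top measurable_cost hJ.ne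
  have e2 : ∀ᵐ ω ∂P, (∫⁻ t in Icc 0 T, ENNReal.ofReal (Φh (ω.1 t)))
      + ENNReal.ofReal (Φg (ω.1 T)) < ∞ :=
    ae_of_ae_map measurable_fst.aemeasurable (hP ▸ ae_lt_top hΦm' hΦ.ne)
  filter_upwards [e1, e2] with ω h1 h2
  rw [← hiff]
  refine integrableOn_derivA hh hΦh hΦh0 hM hgrowth_h (lt_of_le_of_lt ?_ h1)
    (lt_of_le_of_lt le_self_add h2)
  exact le_add_right (le_add_left le_rfl)

theorem lintegral_stopPos_lt_top [IsFiniteMeasure P] [IsFiniteMeasure P']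
    (hg : ∀ l, ContDiffOn ℝ 1 (c.g l) (Ici 0)) (hh : ∀ l, ContDiffOn ℝ 1 (c.h l) (Ici 0))
    (hΦg : Measurable Φg) (hΦh : Measurable Φh) (hΦg0 : ∀ l, 0 ≤ Φg l) (hΦh0 : ∀ l, 0 ≤ Φh l)
    (hM : 0 ≤ M)
    (hΦ : ∫⁻ L : CadlagPath T (EuclideanSpace ℝ (Fin d)),
      ((∫⁻ t in Icc 0 T, ENNReal.ofReal (Φh (L t))) + ENNReal.ofReal (Φg (L T))) ∂P₀ < ∞)
    (hgrowth_g : ∀ l, ∀ a, 0 ≤ a → |derivA c.g l a| ≤ Φg l + M * c.g l a)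
    (hgrowth_h : ∀ l, ∀ a, 0 ≤ a → |derivA c.h l a| ≤ Φh l + M * c.h l a)
    (hP : P.map Prod.fst = P₀) (hJ : c.J P < ∞) (hP' : P'.map Prod.fst = P₀) :
    ∫⁻ ω, c.stopPos ω.1 (startTime ω.2) ∂P' < ∞ := by
  obtain ⟨C, hC⟩ := c.exists_fExt_le
  have hΦm : Measurable fun L : CadlagPath T (EuclideanSpace ℝ (Fin d)) =>
      (∫⁻ t in Icc 0 T, ENNReal.ofReal (Φh (L t))) + ENNReal.ofReal (Φg (L T)) :=
    ((hΦh.comp measurable_eval_uncurry).ennreal_ofReal.lintegral_prod_right').add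
      (hΦg.comp (measurable_eval T)).ennreal_ofReal
  set G : CadlagPath T (EuclideanSpace ℝ (Fin d)) → ℝ≥0∞ := fun L =>
    ENNReal.ofReal C + ENNReal.ofReal (derivA c.g (L T) 0)
      + ∫⁻ t in Icc 0 T, ENNReal.ofReal (derivA c.h (L t) 0) with hG
  have hGm : Measurable G := by
    refine Measurable.add (measurable_const.add (Measurable.ennreal_ofReal ?_)) ?_
    · exact (measurable_derivA c.g_meas (fun l => (hg l).differentiableOn one_ne_zero) le_rfl).comp
        (measurable_eval T)
    · exact (measurable_derivA_path hh).ennreal_ofReal.lintegral_prod_right'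
  have hle : ∀ L s, c.stopPos L s ≤ G L := fun L s => by
    refine add_le_add (add_le_add ?_ ?_) (lintegral_mono fun t => ?_)
    · split_ifs
      · exact ENNReal.ofReal_le_ofReal (hC s)
      · exact zero_le
    · split_ifs <;> simp
    · split_ifs <;> simp
  have hle2 : ∀ ω : PathPair d T, G ω.1 ≤ ENNReal.ofReal C
      + ((∫⁻ t in Icc 0 T, ENNReal.ofReal (Φh (ω.1 t))) + ENNReal.ofReal (Φg (ω.1 T)))
      + ENNReal.ofReal M * c.cost ω := fun ω => by
    have b1 : ENNReal.ofReal (derivA c.g (ω.1 T) 0) ≤ ENNReal.ofReal (Φg (ω.1 T))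
        + ENNReal.ofReal M * ENNReal.ofReal (c.g (ω.1 T) (ω.2 T)) :=
      ofReal_derivWithin_zero_le (hΦg0 _) hM (c.g_nonneg _) (c.g_convex _)
        ((hg _).differentiableOn one_ne_zero) (hgrowth_g _) (ω.2.eval_nonneg T)
    have b2 : (∫⁻ t in Icc 0 T, ENNReal.ofReal (derivA c.h (ω.1 t) 0))
        ≤ (∫⁻ t in Icc 0 T, ENNReal.ofReal (Φh (ω.1 t)))
        + ENNReal.ofReal M * ∫⁻ t in Icc 0 T, ENNReal.ofReal (c.h (ω.1 t) (ω.2 t)) := by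
      have hm : Measurable fun t => ENNReal.ofReal (c.h (ω.1 t) (ω.2 t)) :=
        (measurable_runningCost.comp measurable_prodMk_left).ennreal_ofReal
      rw [← lintegral_const_mul _ hm, ← lintegral_add_right _ (hm.const_mul _)]
      exact lintegral_mono fun t => ofReal_derivWithin_zero_le (hΦh0 _) hM (c.h_nonneg _)
        (c.h_convex _) ((hh _).differentiableOn one_ne_zero) (hgrowth_h _) (ω.2.eval_nonneg t)
    calc G ω.1 ≤ ENNReal.ofReal C + (ENNReal.ofReal (Φg (ω.1 T))
            + ENNReal.ofReal M * ENNReal.ofReal (c.g (ω.1 T) (ω.2 T)))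
          + ((∫⁻ t in Icc 0 T, ENNReal.ofReal (Φh (ω.1 t)))
            + ENNReal.ofReal M * ∫⁻ t in Icc 0 T, ENNReal.ofReal (c.h (ω.1 t) (ω.2 t))) :=
          add_le_add (add_le_add le_rfl b1) b2
      _ = ENNReal.ofReal C
          + ((∫⁻ t in Icc 0 T, ENNReal.ofReal (Φh (ω.1 t))) + ENNReal.ofReal (Φg (ω.1 T)))
          + ENNReal.ofReal M * ((∫⁻ t in Icc 0 T, ENNReal.ofReal (c.h (ω.1 t) (ω.2 t)))
            + ENNReal.ofReal (c.g (ω.1 T) (ω.2 T))) := by ring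
      _ ≤ _ := by
          refine add_le_add le_rfl (mul_le_mul_right ?_ _)
          rw [cost, add_assoc]
          exact le_add_left le_rfl
  calc ∫⁻ ω, c.stopPos ω.1 (startTime ω.2) ∂P' ≤ ∫⁻ ω, G ω.1 ∂P' :=
        lintegral_mono fun ω => hle _ _
    _ = ∫⁻ ω, G ω.1 ∂P := by
        rw [← lintegral_map hGm measurable_fst, ← lintegral_map hGm measurable_fst, hP, hP']
    _ ≤ ∫⁻ ω, (ENNReal.ofReal C
      + ((∫⁻ t in Icc 0 T, ENNReal.ofReal (Φh (ω.1 t))) + ENNReal.ofReal (Φg (ω.1 T)))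
      + ENNReal.ofReal M * c.cost ω) ∂P := lintegral_mono hle2
    _ = ENNReal.ofReal C * P univ + ∫⁻ L : CadlagPath T (EuclideanSpace ℝ (Fin d)),
        ((∫⁻ t in Icc 0 T, ENNReal.ofReal (Φh (L t))) + ENNReal.ofReal (Φg (L T))) ∂P₀
        + ENNReal.ofReal M * c.J P := by
        rw [lintegral_add_right _ (measurable_cost.const_mul _),
          lintegral_add_left measurable_const, lintegral_const,
          lintegral_const_mul _ measurable_cost, ← hP, lintegral_map hΦm measurable_fst, J]
    _ < ∞ := ENNReal.add_lt_top.2 ⟨ENNReal.add_lt_top.2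
        ⟨ENNReal.mul_lt_top ENNReal.ofReal_lt_top (measure_lt_top _ _), hΦ⟩,
        ENNReal.mul_lt_top ENNReal.ofReal_lt_top hJ⟩

end CostIngredients

end Integrability

section Limit

variable {d : ℕ} {T : ℝ} [hT : Fact (0 < T)] {c : CostIngredients d T}
  {Φg Φh : EuclideanSpace ℝ (Fin d) → ℝ} {M : ℝ}
  {P₀ : Measure (CadlagPath T (EuclideanSpace ℝ (Fin d)))} {P P' : Measure (PathPair d T)}

theorem IncreasingPath.stieltjes_bottom_Iio_startTime (A : IncreasingPath T) (hA : 0 < A T)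
    (ε : ℝ≥0) : (A.bottom ε).stieltjes.measure (Iio (startTime A)) = 0 := by
  have hsub : Iio (startTime A) ⊆ ⋃ (q : ℚ) (_ : (q : ℝ) < startTime A), Iic (q : ℝ) := by
    intro t ht
    obtain ⟨q, hq1, hq2⟩ := exists_rat_btwn (mem_Iio.1 ht)
    exact mem_iUnion₂.2 ⟨q, hq2, hq1.le⟩
  refine measure_mono_null hsub ?_
  refine measure_iUnion_null fun q => measure_iUnion_null fun hq => ?_
  rw [stieltjes_Iic]
  split_ifs with h0
  · simp
  · have hnp : ¬ 0 < A q := fun h =>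
      absurd (startTime_le_of_pos ⟨not_lt.1 h0, hq.le.trans (startTime_mem hA).2⟩ h) (not_le.2 hq)
    rw [bottom_eval, le_antisymm (not_lt.1 hnp) (A.eval_nonneg _), min_eq_left ε.coe_nonneg,
      ENNReal.ofReal_zero]

/-- The bottom part of `A` of small height is concentrated close to the start time. -/
theorem IncreasingPath.le_stieltjes_bottom_Icc (A : IncreasingPath T) {ε : ℝ≥0} {u : ℝ}
    (hu : u ∈ Icc 0 T) (hA : 0 < A u) (hε : ε ≤ A u) :
    (ε : ℝ≥0∞) ≤ (A.bottom ε).stieltjes.measure (Icc (startTime A) u) := by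
  have h1 : (A.bottom ε).stieltjes.measure (Iic u) = ε := by
    rw [stieltjes_Iic, if_neg (not_lt.2 hu.1), bottom_eval, min_eq_right hε,
      ENNReal.ofReal_coe_nnreal]
  have h2 := A.stieltjes_bottom_Iio_startTime (hA.trans_le (A.eval_le u)) ε
  calc (ε : ℝ≥0∞) = (A.bottom ε).stieltjes.measure (Iic u) := h1.symm
    _ ≤ (A.bottom ε).stieltjes.measure (Iio (startTime A) ∪ Icc (startTime A) u) := by
        refine measure_mono fun t ht => ?_
        rcases lt_or_ge t (startTime A) with h | h
        · exact Or.inl h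
        · exact Or.inr ⟨h, ht⟩
    _ ≤ _ := (measure_union_le _ _).trans (by rw [h2, zero_add])

namespace CostIngredients

theorem tendsto_controlError (c : CostIngredients d T) (A : IncreasingPath T) :
    Tendsto (fun ε => c.controlError ε A) (𝓝[>] 0) (𝓝 0) := by
  by_cases hA : startTime A ≤ T
  swap
  · simp [controlError, hA]
  have hm := startTime_mem (startTime_le_iff_pos.1 hA)
  set τ := startTime A with hτ
  rw [ENNReal.tendsto_nhds_zero]
  intro r hr
  obtain ⟨η, hη0, hηr⟩ := ENNReal.lt_iff_exists_nnreal_btwn.1 hr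
  have hη : (0 : ℝ) < η := by exact_mod_cast hη0
  obtain ⟨δ, hδ, hf⟩ := Metric.continuousAt_iff.1 (c.continuous_fExt.continuousAt (x := τ)) η hη
  obtain ⟨u, hu, hAu, huδ⟩ : ∃ u, u ∈ Icc τ T ∧ 0 < A u ∧ u < τ + δ := by
    rcases hm.2.lt_or_eq with h | h
    · obtain ⟨u, hu1, hu2⟩ := exists_between (lt_min h (by linarith : τ < τ + δ))
      have huT := (hu2.trans_le (min_le_left _ _)).le
      exact ⟨u, ⟨hu1.le, huT⟩, pos_of_startTime_lt huT hu1, hu2.trans_le (min_le_right _ _)⟩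
    · exact ⟨T, ⟨hm.2, le_rfl⟩, startTime_le_iff_pos.1 hA, by linarith⟩
  have hu0 : u ∈ Icc 0 T := ⟨hm.1.trans hu.1, hu.2⟩
  have hev : ∀ᶠ ε : ℝ≥0 in 𝓝[>] 0, (ε : ℝ) < A u := by
    have : ∀ᶠ ε : ℝ≥0 in 𝓝 0, (ε : ℝ) < A u :=
      NNReal.continuous_coe.continuousAt.eventually (Iio_mem_nhds (by simpa using hAu))
    exact nhdsWithin_le_nhds this
  filter_upwards [hev, self_mem_nhdsWithin] with ε hε hε0
  have hεne : (ε : ℝ≥0∞) ≠ 0 := by exact_mod_cast (ne_of_gt hε0)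
  have hcost : ENNReal.ofReal (c.fExt τ - η) * ε ≤ c.controlCost (A.bottom ε) := by
    rw [controlCost]
    calc ENNReal.ofReal (c.fExt τ - η) * ε
        ≤ ENNReal.ofReal (c.fExt τ - η) * (A.bottom ε).stieltjes.measure (Icc τ u) := by
          gcongr
          exact A.le_stieltjes_bottom_Icc hu0 hAu hε.le
      _ = ∫⁻ _ in Icc τ u, ENNReal.ofReal (c.fExt τ - η) ∂(A.bottom ε).stieltjes.measure := by
          rw [setLIntegral_const]
      _ ≤ ∫⁻ t in Icc τ u, ENNReal.ofReal (c.f t) ∂(A.bottom ε).stieltjes.measure := by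
          refine setLIntegral_mono' measurableSet_Icc fun t ht => ENNReal.ofReal_le_ofReal ?_
          have htd : dist t τ < δ := by
            rw [Real.dist_eq, abs_of_nonneg (sub_nonneg.2 ht.1)]
            linarith [ht.2]
          have := (abs_lt.1 (hf htd)).1
          rw [← c.fExt_of_mem ⟨hm.1.trans ht.1, ht.2.trans hu.2⟩]
          linarith
      _ ≤ _ := lintegral_mono_set (Icc_subset_Icc hm.1 hu.2)
  rw [controlError, if_pos hA, ← hτ]
  refine le_trans ?_ hηr.le
  rw [tsub_le_iff_left]
  calc ENNReal.ofReal (c.fExt τ) ≤ ENNReal.ofReal (c.fExt τ - η) + ENNReal.ofReal η := by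
        simpa using ENNReal.ofReal_add_le (p := c.fExt τ - η) (q := η)
    _ ≤ _ := by
        rw [ENNReal.ofReal_coe_nnreal]
        gcongr
        calc ENNReal.ofReal (c.fExt τ - η)
            = (ε : ℝ≥0∞)⁻¹ * (ENNReal.ofReal (c.fExt τ - η) * ε) := by
              rw [mul_comm, mul_assoc, ENNReal.mul_inv_cancel hεne ENNReal.coe_ne_top, mul_one]
          _ ≤ _ := by gcongr

/-- A bound for the error terms. -/
theorem ofReal_bottomError_le {φ : ℝ → ℝ} {Φ : ℝ} (hΦ : 0 ≤ Φ) (hM : 0 ≤ M)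
    (h0 : ∀ a, 0 ≤ a → 0 ≤ φ a) (hd : DifferentiableOn ℝ φ (Ici 0))
    (hg : ∀ a, 0 ≤ a → |derivWithin φ (Ici 0) a| ≤ Φ + M * φ a) {a : ℝ} (ha : 0 ≤ a) {ε : ℝ≥0}
    (hε1 : ε ≤ 1) :
    ENNReal.ofReal (bottomError φ ε a)
      ≤ ENNReal.ofReal (3 * (1 + M * Real.exp (M + 1))) * (ENNReal.ofReal Φ
        + ENNReal.ofReal (φ a)) := by
  rw [← ENNReal.ofReal_add hΦ (h0 a ha), ← ENNReal.ofReal_mul (by positivity)]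
  refine ENNReal.ofReal_le_ofReal ((bottomError_le hΦ hM h0 hd hg ha ε.2 hε1).trans ?_)
  nlinarith [h0 a ha]

theorem tendsto_lintegral_replaceError [IsFiniteMeasure P]
    (hg : ∀ l, ContDiffOn ℝ 1 (c.g l) (Ici 0)) (hh : ∀ l, ContDiffOn ℝ 1 (c.h l) (Ici 0))
    (hΦg : Measurable Φg) (hΦh : Measurable Φh) (hΦg0 : ∀ l, 0 ≤ Φg l) (hΦh0 : ∀ l, 0 ≤ Φh l)
    (hM : 0 ≤ M)
    (hΦ : ∫⁻ L : CadlagPath T (EuclideanSpace ℝ (Fin d)),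
      ((∫⁻ t in Icc 0 T, ENNReal.ofReal (Φh (L t))) + ENNReal.ofReal (Φg (L T))) ∂P₀ < ∞)
    (hgrowth_g : ∀ l, ∀ a, 0 ≤ a → |derivA c.g l a| ≤ Φg l + M * c.g l a)
    (hgrowth_h : ∀ l, ∀ a, 0 ≤ a → |derivA c.h l a| ≤ Φh l + M * c.h l a)
    (hP : P.map Prod.fst = P₀) (hJ : c.J P < ∞) {ε : ℕ → ℝ≥0} (hε0 : ∀ n, 0 < ε n)
    (hε1 : ∀ n, ε n ≤ 1) (hε : Tendsto ε atTop (𝓝 0)) :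
    Tendsto (fun n => ∫⁻ ω, c.replaceError (ε n) ω ∂P) atTop (𝓝 0) := by
  have hε' : Tendsto ε atTop (𝓝[>] 0) :=
    tendsto_nhdsWithin_iff.2 ⟨hε, Eventually.of_forall hε0⟩
  have hεr : Tendsto (fun n => (ε n : ℝ)) atTop (𝓝[>] 0) :=
    tendsto_nhdsWithin_iff.2 ⟨by rw [← NNReal.coe_zero]; exact NNReal.tendsto_coe.2 hε,
      Eventually.of_forall fun n => by exact_mod_cast hε0 n⟩
  set K : ℝ≥0∞ := ENNReal.ofReal (3 * (1 + M * Real.exp (M + 1)))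
  have hΦhm : Measurable fun L : CadlagPath T (EuclideanSpace ℝ (Fin d)) =>
      ∫⁻ t in Icc 0 T, ENNReal.ofReal (Φh (L t)) :=
    (hΦh.comp measurable_eval_uncurry).ennreal_ofReal.lintegral_prod_right'
  have hΦgm : Measurable fun L : CadlagPath T (EuclideanSpace ℝ (Fin d)) =>
      ENNReal.ofReal (Φg (L T)) := (hΦg.comp (measurable_eval T)).ennreal_ofReal
  have hΦP : ∫⁻ ω : PathPair d T, ((∫⁻ t in Icc 0 T, ENNReal.ofReal (Φh (ω.1 t)))
      + ENNReal.ofReal (Φg (ω.1 T))) ∂P < ∞ := by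
    have hm : Measurable fun L : CadlagPath T (EuclideanSpace ℝ (Fin d)) =>
        (∫⁻ t in Icc 0 T, ENNReal.ofReal (Φh (L t))) + ENNReal.ofReal (Φg (L T)) := hΦhm.add hΦgm
    rwa [← hP, lintegral_map hm measurable_fst] at hΦ
  have l1 : Tendsto (fun n => ∫⁻ ω, c.controlError (ε n) ω.2 ∂P) atTop (𝓝 0) := by
    obtain ⟨C, hC⟩ := c.exists_fExt_le
    have := tendsto_lintegral_of_dominated_convergence (μ := P)
      (F := fun n (ω : PathPair d T) => c.controlError (ε n) ω.2) (f := fun _ => 0)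
      (fun _ => ENNReal.ofReal C) (fun n => measurable_controlError (ε n))
      (fun n => Eventually.of_forall fun ω => ?_) (by
        rw [lintegral_const]
        exact (ENNReal.mul_lt_top ENNReal.ofReal_lt_top (measure_lt_top _ _)).ne)
      (Eventually.of_forall fun ω => (c.tendsto_controlError ω.2).comp hε')
    · simpa using this
    · refine tsub_le_self.trans ?_
      split_ifs
      · exact ENNReal.ofReal_le_ofReal (hC _)
      · exact zero_le
  have l2 : Tendsto (fun n => ∫⁻ ω : PathPair d T,
      ENNReal.ofReal (bottomError (c.g (ω.1 T)) (ε n) (ω.2 T)) ∂P) atTop (𝓝 0) := by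
    have := tendsto_lintegral_of_dominated_convergence (μ := P)
      (F := fun n (ω : PathPair d T) => ENNReal.ofReal (bottomError (c.g (ω.1 T)) (ε n) (ω.2 T)))
      (f := fun _ => 0)
      (fun ω => K * (ENNReal.ofReal (Φg (ω.1 T)) + ENNReal.ofReal (c.g (ω.1 T) (ω.2 T))))
      (fun n => (measurable_bottomError_terminal hg (ε n)).ennreal_ofReal)
      (fun n => Eventually.of_forall fun ω => ofReal_bottomError_le (hΦg0 _) hM (c.g_nonneg _)
        ((hg _).differentiableOn one_ne_zero) (hgrowth_g _) (ω.2.eval_nonneg T) (hε1 n)) ?_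
      (Eventually.of_forall fun ω => ?_)
    · simpa using this
    · have hm : Measurable fun ω : PathPair d T => ENNReal.ofReal (Φg (ω.1 T)) :=
        hΦgm.comp measurable_fst
      rw [lintegral_const_mul' _ _ ENNReal.ofReal_ne_top, lintegral_add_left hm]
      refine (ENNReal.mul_lt_top ENNReal.ofReal_lt_top (ENNReal.add_lt_top.2 ⟨?_, ?_⟩)).ne
      · exact (lintegral_mono fun ω => le_add_left le_rfl).trans_lt hΦP
      · exact (lintegral_mono fun ω => le_add_left le_rfl).trans_lt hJ
    · simpa using ENNReal.tendsto_ofReal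
        ((tendsto_bottomError (hg (ω.1 T)) (ω.2.eval_nonneg T)).comp hεr)
  have l3 : Tendsto (fun n => ∫⁻ ω : PathPair d T, (∫⁻ t in Icc 0 T,
      ENNReal.ofReal (bottomError (c.h (ω.1 t)) (ε n) (ω.2 t))) ∂P) atTop (𝓝 0) := by
    have hmΦ : Measurable fun p : PathPair d T × ℝ => ENNReal.ofReal (Φh (p.1.1 p.2)) :=
      (hΦh.comp (measurable_eval_uncurry.comp ((measurable_fst.comp measurable_fst).prodMk
        measurable_snd))).ennreal_ofReal
    have hmh : Measurable fun p : PathPair d T × ℝ =>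
        ENNReal.ofReal (c.h (p.1.1 p.2) (p.1.2 p.2)) :=
      measurable_runningCost.ennreal_ofReal
    have := tendsto_lintegral_of_dominated_convergence (μ := P.prod (volume.restrict (Icc 0 T)))
      (F := fun n (p : PathPair d T × ℝ) =>
        ENNReal.ofReal (bottomError (c.h (p.1.1 p.2)) (ε n) (p.1.2 p.2)))
      (f := fun _ => 0)
      (fun p => K * (ENNReal.ofReal (Φh (p.1.1 p.2))
        + ENNReal.ofReal (c.h (p.1.1 p.2) (p.1.2 p.2))))
      (fun n => (measurable_bottomError_path hh (ε n)).ennreal_ofReal)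
      (fun n => Eventually.of_forall fun p => ofReal_bottomError_le (hΦh0 _) hM (c.h_nonneg _)
        ((hh _).differentiableOn one_ne_zero) (hgrowth_h _) (p.1.2.eval_nonneg p.2) (hε1 n)) ?_
      (Eventually.of_forall fun p => ?_)
    · rw [lintegral_zero] at this
      refine this.congr fun n => ?_
      exact lintegral_prod _ (measurable_bottomError_path hh (ε n)).ennreal_ofReal.aemeasurable
    · rw [lintegral_const_mul' _ _ ENNReal.ofReal_ne_top, lintegral_add_left hmΦ,
        lintegral_prod _ hmΦ.aemeasurable, lintegral_prod _ hmh.aemeasurable]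
      refine (ENNReal.mul_lt_top ENNReal.ofReal_lt_top (ENNReal.add_lt_top.2 ⟨?_, ?_⟩)).ne
      · exact (lintegral_mono fun ω => le_add_right le_rfl).trans_lt hΦP
      · exact (lintegral_mono fun ω => le_add_right (le_add_left le_rfl)).trans_lt hJ
    · simpa using ENNReal.tendsto_ofReal
        ((tendsto_bottomError (hh (p.1.1 p.2)) (p.1.2.eval_nonneg p.2)).comp hεr)
  have hsum := (l1.add l2).add l3
  rw [add_zero, add_zero] at hsum
  refine hsum.congr fun n => ?_
  have m1 := measurable_controlError (c := c) (ε n)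
  have m2 := (measurable_bottomError_terminal hg (ε n)).ennreal_ofReal
  have m12 : Measurable fun ω : PathPair d T => c.controlError (ε n) ω.2
      + ENNReal.ofReal (bottomError (c.g (ω.1 T)) (ε n) (ω.2 T)) := m1.add m2
  rw [← lintegral_add_left m1, ← lintegral_add_left m12]
  rfl

/-- The first-order condition for optimality in the monotone-follower problem, with the positive
and negative terms of the stopping costs separated. -/
theorem stopPos_add_stopNeg_le [IsProbabilityMeasure P] [IsProbabilityMeasure P']
    (hg : ∀ l, ContDiffOn ℝ 1 (c.g l) (Ici 0)) (hh : ∀ l, ContDiffOn ℝ 1 (c.h l) (Ici 0))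
    (hΦg : Measurable Φg) (hΦh : Measurable Φh) (hΦg0 : ∀ l, 0 ≤ Φg l) (hΦh0 : ∀ l, 0 ≤ Φh l)
    (hM : 0 ≤ M)
    (hΦ : ∫⁻ L : CadlagPath T (EuclideanSpace ℝ (Fin d)),
      ((∫⁻ t in Icc 0 T, ENNReal.ofReal (Φh (L t))) + ENNReal.ofReal (Φg (L T))) ∂P₀ < ∞)
    (hgrowth_g : ∀ l, ∀ a, 0 ≤ a → |derivA c.g l a| ≤ Φg l + M * c.g l a)
    (hgrowth_h : ∀ l, ∀ a, 0 ≤ a → |derivA c.h l a| ≤ Φh l + M * c.h l a)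
    (hP : IsFollowerSolution P₀ c P) (hP' : Admissible P₀ P') :
    ∫⁻ ω, c.stopPos ω.1 (startTime ω.2) ∂P + ∫⁻ ω, c.stopNeg ω.1 (startTime ω.2) ∂P'
      ≤ ∫⁻ ω, c.stopPos ω.1 (startTime ω.2) ∂P'
        + ∫⁻ ω, c.stopNeg ω.1 (startTime ω.2) ∂P := by
  obtain ⟨hadm, hJ, hmin⟩ := hP
  obtain ⟨Q, hQ, hQ1, hQ2, hQ3⟩ := exists_gluing hadm hP'
  have hτm : Measurable fun ω : PathPair d T => (ω.1, startTime ω.2) :=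
    measurable_fst.prodMk measurable_startTime_snd
  have hFm : Measurable fun p : PathPair d T × ℝ => (p.1.1, p.2) :=
    (measurable_fst.comp measurable_fst).prodMk measurable_snd
  have hpos := measurable_stopPos (c := c) hg hh
  have hneg := measurable_stopNeg (c := c) hg hh
  have q1 : ∀ F : PathPair d T → ℝ≥0∞, Measurable F → ∫⁻ p, F p.1 ∂Q = ∫⁻ ω, F ω ∂P :=
    fun F hF => by rw [← hQ1, lintegral_map hF measurable_fst]
  have q2 : ∀ F : CadlagPath T (EuclideanSpace ℝ (Fin d)) × ℝ → ℝ≥0∞, Measurable F →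
      ∫⁻ p, F (p.1.1, p.2) ∂Q = ∫⁻ ω, F (ω.1, startTime ω.2) ∂P' := fun F hF => by
    rw [← lintegral_map hF hFm, hQ2, lintegral_map hF hτm]
  have hae : ∀ᵐ p ∂Q, p.2 ∈ Icc 0 T ∨ p.2 = T + 1 := by
    have hset : MeasurableSet {x : CadlagPath T (EuclideanSpace ℝ (Fin d)) × ℝ |
        x.2 ∈ Icc 0 T ∨ x.2 = T + 1} :=
      (measurable_snd measurableSet_Icc).union (measurable_snd (measurableSet_singleton (T + 1)))
    have h1 : ∀ᵐ x ∂(Q.map fun p : PathPair d T × ℝ => (p.1.1, p.2)),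
        x.2 ∈ Icc 0 T ∨ x.2 = T + 1 := by
      rw [hQ2, ae_map_iff hτm.aemeasurable hset]
      exact Eventually.of_forall fun ω => startTime_mem_or ω.2
    exact ae_of_ae_map hFm.aemeasurable h1
  have step : ∀ ε : ℝ≥0, 0 < ε →
      ∫⁻ ω, c.stopPos ω.1 (startTime ω.2) ∂P + ∫⁻ ω, c.stopNeg ω.1 (startTime ω.2) ∂P'
      ≤ ∫⁻ ω, c.stopPos ω.1 (startTime ω.2) ∂P'
        + ∫⁻ ω, c.stopNeg ω.1 (startTime ω.2) ∂P + ∫⁻ ω, c.replaceError ε ω ∂P := by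
    intro ε hε
    have herr : Measurable (c.replaceError ε) :=
      ((measurable_controlError ε).add (measurable_bottomError_terminal hg ε).ennreal_ofReal).add
        (measurable_bottomError_path hh ε).ennreal_ofReal.lintegral_prod_right'
    have h1 : ∫⁻ p, (c.cost (replaceMap ε p)
          + ε * (c.stopPos p.1.1 (startTime p.1.2) + c.stopNeg p.1.1 p.2)) ∂Q
        ≤ ∫⁻ p, (c.cost p.1 + ε * (c.stopPos p.1.1 p.2 + c.stopNeg p.1.1 (startTime p.1.2)
          + c.replaceError ε p.1)) ∂Q :=
      lintegral_mono_ae (hae.mono fun p hp => cost_replaceMap_le hg hh p.1 hε hp)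
    have hJ' : c.J P ≤ ∫⁻ p, c.cost (replaceMap ε p) ∂Q := by
      rw [← lintegral_map measurable_cost (measurable_replaceMap ε)]
      rw [hmin]
      exact iInf₂_le _ (hQ3 ε)
    have m1 : Measurable fun p : PathPair d T × ℝ => c.stopPos p.1.1 (startTime p.1.2) :=
      (hpos.comp hτm).comp measurable_fst
    have m2 : Measurable fun p : PathPair d T × ℝ => c.stopNeg p.1.1 p.2 := hneg.comp hFm
    have m3 : Measurable fun p : PathPair d T × ℝ => c.stopPos p.1.1 p.2 := hpos.comp hFm
    have m4 : Measurable fun p : PathPair d T × ℝ => c.stopNeg p.1.1 (startTime p.1.2) :=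
      (hneg.comp hτm).comp measurable_fst
    have m5 : Measurable fun p : PathPair d T × ℝ => c.cost (replaceMap ε p) :=
      measurable_cost.comp (measurable_replaceMap ε)
    have m6 : Measurable fun p : PathPair d T × ℝ => c.cost p.1 :=
      measurable_cost.comp measurable_fst
    have m7 : Measurable fun p : PathPair d T × ℝ =>
        c.stopPos p.1.1 p.2 + c.stopNeg p.1.1 (startTime p.1.2) := m3.add m4
    rw [lintegral_add_left m5, lintegral_const_mul' _ _ ENNReal.coe_ne_top, lintegral_add_left m1,
      lintegral_add_left m6, lintegral_const_mul' _ _ ENNReal.coe_ne_top, lintegral_add_left m7,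
      lintegral_add_left m3,
      q1 _ measurable_cost, q1 _ herr, q1 (fun ω => c.stopPos ω.1 (startTime ω.2)) (hpos.comp hτm),
      q1 (fun ω => c.stopNeg ω.1 (startTime ω.2)) (hneg.comp hτm), q2 _ hpos, q2 _ hneg] at h1
    have h2 := (add_le_add hJ' le_rfl).trans h1
    have h3 := (ENNReal.add_le_add_iff_left hJ.ne).1 h2
    exact (ENNReal.mul_le_mul_iff_right (by exact_mod_cast hε.ne') ENNReal.coe_ne_top).1 h3
  have hlim := tendsto_lintegral_replaceError hg hh hΦg hΦh hΦg0 hΦh0 hM hΦ hgrowth_g hgrowth_h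
    hadm.marginal hJ (ε := fun n => 1 / ((n : ℝ≥0) + 1)) (fun n => by positivity)
    (fun n => by
      rw [div_le_one (by positivity)]
      exact le_add_left le_rfl)
    tendsto_one_div_add_atTop_nhds_zero_nat
  have hlim2 := hlim.const_add (∫⁻ ω, c.stopPos ω.1 (startTime ω.2) ∂P'
    + ∫⁻ ω, c.stopNeg ω.1 (startTime ω.2) ∂P)
  rw [add_zero] at hlim2
  exact ge_of_tendsto' hlim2 fun n => step _ (by positivity)

end CostIngredients

end Limit

theorem add_le_add_of_balance {p n p' n' a b a' b' : ℝ≥0∞} (hp : p ≠ ∞) (hp' : p' ≠ ∞) (ha : a ≠ ∞)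
    (ha' : a' ≠ ∞) (h : p + n' ≤ p' + n) (h1 : a + n = p + b) (h2 : a' + n' = p' + b') :
    a + b' ≤ a' + b := by
  by_cases hb : b = ∞
  · simp [hb]
  have hn : n ≠ ∞ := fun hn => by
    rw [hn, add_top] at h1
    exact ENNReal.add_ne_top.2 ⟨hp, hb⟩ h1.symm
  have hn' : n' ≠ ∞ := fun hn' => by
    rw [hn', add_top, top_le_iff] at h
    exact ENNReal.add_ne_top.2 ⟨hp', hn⟩ h
  have hb' : b' ≠ ∞ := fun hb' => by
    rw [hb', add_top] at h2
    exact ENNReal.add_ne_top.2 ⟨ha', hn'⟩ h2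
  lift p to ℝ≥0 using hp
  lift p' to ℝ≥0 using hp'
  lift a to ℝ≥0 using ha
  lift a' to ℝ≥0 using ha'
  lift b to ℝ≥0 using hb
  lift b' to ℝ≥0 using hb'
  lift n to ℝ≥0 using hn
  lift n' to ℝ≥0 using hn'
  norm_cast at *
  rw [← NNReal.coe_le_coe] at *
  rw [← NNReal.coe_inj] at h1 h2
  push_cast at *
  linarith

theorem coe_sub_coe_le_of_add_le_add {a b a' b' : ℝ≥0∞} (ha : a ≠ ∞) (ha' : a' ≠ ∞)
    (h : a + b' ≤ a' + b) : (a : EReal) - (b : EReal) ≤ (a' : EReal) - (b' : EReal) := by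
  lift a to ℝ≥0 using ha
  lift a' to ℝ≥0 using ha'
  by_cases hb : b = ∞
  · simp [hb]
  have hb' : b' ≠ ∞ := fun hb' => by
    rw [hb', add_top, top_le_iff] at h
    exact ENNReal.add_ne_top.2 ⟨ENNReal.coe_ne_top, hb⟩ h
  lift b to ℝ≥0 using hb
  lift b' to ℝ≥0 using hb'
  norm_cast at h
  rw [← NNReal.coe_le_coe] at h
  push_cast at h
  have : ((a : ℝ) : EReal) - ((b : ℝ) : EReal) ≤ ((a' : ℝ) : EReal) - ((b' : ℝ) : EReal) := by
    rw [← EReal.coe_sub, ← EReal.coe_sub, EReal.coe_le_coe_iff]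
    linarith
  exact this

theorem Admissible.isProbabilityMeasure {d : ℕ} {T : ℝ}
    {P₀ : Measure (CadlagPath T (EuclideanSpace ℝ (Fin d)))} {P : Measure (PathPair d T)}
    [IsProbabilityMeasure P₀] (h : Admissible P₀ P) :
    IsProbabilityMeasure P :=
  ⟨by rw [← preimage_univ (f := Prod.fst), ← Measure.map_apply measurable_fst MeasurableSet.univ,
    h.marginal, measure_univ]⟩

section Expectation

variable {d : ℕ} {T : ℝ} [hT : Fact (0 < T)] {c : CostIngredients d T}
  {P₀ : Measure (CadlagPath T (EuclideanSpace ℝ (Fin d)))} {P P' : Measure (PathPair d T)}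

namespace CostIngredients

theorem lintegral_stoppingCost_parts (hg : ∀ l, ContDiffOn ℝ 1 (c.g l) (Ici 0))
    (hh : ∀ l, ContDiffOn ℝ 1 (c.h l) (Ici 0))
    (hint : ∀ᵐ L ∂P₀, IntegrableOn (fun t => derivA c.h (L t) 0) (Icc 0 T))
    (hP : P.map Prod.fst = P₀) :
    ∫⁻ ω, ENNReal.ofReal (c.stoppingCost ω) ∂P + ∫⁻ ω, c.stopNeg ω.1 (startTime ω.2) ∂P
      = ∫⁻ ω, c.stopPos ω.1 (startTime ω.2) ∂P
        + ∫⁻ ω, ENNReal.ofReal (-c.stoppingCost ω) ∂P := by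
  have hZ := measurable_stoppingCost (c := c) hg hh
  have hZ' : Measurable fun ω => ENNReal.ofReal (-c.stoppingCost ω) := hZ.neg.ennreal_ofReal
  rw [← lintegral_add_left hZ.ennreal_ofReal, ← lintegral_add_right _ hZ']
  refine lintegral_congr_ae ?_
  have hae : ∀ᵐ ω ∂P, IntegrableOn (fun t => derivA c.h (ω.1 t) 0) (Icc 0 T) :=
    ae_of_ae_map measurable_fst.aemeasurable (hP ▸ hint)
  filter_upwards [hae] with ω hω
  exact stoppingCost_parts hω

theorem lintegral_stoppingCost_le
    (hint : ∀ᵐ L ∂P₀, IntegrableOn (fun t => derivA c.h (L t) 0) (Icc 0 T))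
    (hP : P.map Prod.fst = P₀) :
    ∫⁻ ω, ENNReal.ofReal (c.stoppingCost ω) ∂P
      ≤ ∫⁻ ω, c.stopPos ω.1 (startTime ω.2) ∂P := by
  refine lintegral_mono_ae ?_
  have hae : ∀ᵐ ω ∂P, IntegrableOn (fun t => derivA c.h (ω.1 t) 0) (Icc 0 T) :=
    ae_of_ae_map measurable_fst.aemeasurable (hP ▸ hint)
  filter_upwards [hae] with ω hω
  have h := stoppingCost_parts (c := c) hω
  rcases le_total 0 (c.stoppingCost ω) with h0 | h0
  · rw [ENNReal.ofReal_of_nonpos (neg_nonpos.2 h0), add_zero] at h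
    exact h ▸ le_self_add
  · rw [ENNReal.ofReal_of_nonpos h0]
    exact zero_le

end CostIngredients

end Expectation

end MonotoneFollower

end

open MonotoneFollower

theorem theorem2p14 {d : ℕ} {T : ℝ} [Fact (0 < T)]
    (P₀ : Measure (MonotoneFollower.CadlagPath T (EuclideanSpace ℝ (Fin d))))
    [IsProbabilityMeasure P₀]
    (c : MonotoneFollower.CostIngredients d T)
    (hg : ∀ l, ContDiffOn ℝ 1 (c.g l) (Ici 0))
    (hh : ∀ l, ContDiffOn ℝ 1 (c.h l) (Ici 0))
    (Φg Φh : EuclideanSpace ℝ (Fin d) → ℝ) (M : ℝ)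
    (hΦg : Measurable Φg) (hΦh : Measurable Φh)
    (hΦg0 : ∀ l, 0 ≤ Φg l) (hΦh0 : ∀ l, 0 ≤ Φh l) (hM : 0 ≤ M)
    (hΦ : ∫⁻ L, ((∫⁻ t in Icc 0 T, ENNReal.ofReal (Φh (L t))) + ENNReal.ofReal (Φg (L T))) ∂P₀ < ∞)
    (hgrowth_g : ∀ l, ∀ a, 0 ≤ a → |MonotoneFollower.derivA c.g l a| ≤ Φg l + M * c.g l a)
    (hgrowth_h : ∀ l, ∀ a, 0 ≤ a → |MonotoneFollower.derivA c.h l a| ≤ Φh l + M * c.h l a)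
    (P : Measure (MonotoneFollower.PathPair d T))
    (hP : MonotoneFollower.IsFollowerSolution P₀ c P) :
    -- the stopping objective is well defined in `[-∞,∞)` for every admissible control
    (∀ᵐ L ∂P₀, IntervalIntegrable (fun t => MonotoneFollower.derivA c.h (L t) 0) volume 0 T) ∧
    (∀ P', MonotoneFollower.Admissible P₀ P' →
      AEMeasurable c.stoppingCost P' ∧ ∫⁻ ω, ENNReal.ofReal (c.stoppingCost ω) ∂P' < ∞) ∧
    -- `P` minimizes it over all admissible controls
    (∀ P', MonotoneFollower.Admissible P₀ P' → c.extendedK P ≤ c.extendedK P') ∧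
    -- `P` solves the optimal-stopping problem over `𝒜_S` as soon as it belongs to `𝒜_S`
    (MonotoneFollower.StoppingAdmissible P₀ c P → MonotoneFollower.IsStoppingSolution P₀ c P) := by
  have hT : 0 < T := Fact.out
  have hPp := hP.1.isProbabilityMeasure
  have hint : ∀ᵐ L ∂P₀, IntegrableOn (fun t => derivA c.h (L t) 0) (Icc 0 T) :=
    CostIngredients.ae_integrableOn_derivA hh hΦh hΦh0 hM hΦ hΦg hgrowth_h hP.1.marginal hP.2.1
  have hpos : ∀ P', Admissible P₀ P' → ∫⁻ ω, c.stopPos ω.1 (startTime ω.2) ∂P' < ∞ :=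
    fun P' hP' => by
      have := hP'.isProbabilityMeasure
      exact CostIngredients.lintegral_stopPos_lt_top hg hh hΦg hΦh hΦg0 hΦh0 hM hΦ hgrowth_g
        hgrowth_h hP.1.marginal hP.2.1 hP'.marginal
  have hZpos : ∀ P', Admissible P₀ P' → ∫⁻ ω, ENNReal.ofReal (c.stoppingCost ω) ∂P' < ∞ :=
    fun P' hP' =>
      (CostIngredients.lintegral_stoppingCost_le hint hP'.marginal).trans_lt (hpos P' hP')
  have main : ∀ P', Admissible P₀ P' →
      ∫⁻ ω, ENNReal.ofReal (c.stoppingCost ω) ∂P + ∫⁻ ω, ENNReal.ofReal (-c.stoppingCost ω) ∂P'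
      ≤ ∫⁻ ω, ENNReal.ofReal (c.stoppingCost ω) ∂P'
        + ∫⁻ ω, ENNReal.ofReal (-c.stoppingCost ω) ∂P := fun P' hP' => by
    have := hP'.isProbabilityMeasure
    exact add_le_add_of_balance (hpos P hP.1).ne (hpos P' hP').ne (hZpos P hP.1).ne
      (hZpos P' hP').ne
      (CostIngredients.stopPos_add_stopNeg_le hg hh hΦg hΦh hΦg0 hΦh0 hM hΦ hgrowth_g hgrowth_h
        hP hP')
      (CostIngredients.lintegral_stoppingCost_parts hg hh hint hP.1.marginal)
      (CostIngredients.lintegral_stoppingCost_parts hg hh hint hP'.marginal)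
  refine ⟨?_, fun P' hP' => ⟨(CostIngredients.measurable_stoppingCost hg hh).aemeasurable,
    hZpos P' hP'⟩, fun P' hP' => ?_, fun hS => ⟨hS, fun P' hP' => ?_⟩⟩
  · filter_upwards [hint] with L hL
    rw [intervalIntegrable_iff_integrableOn_Icc_of_le hT.le]
    exact hL
  · exact coe_sub_coe_le_of_add_le_add (hZpos P hP.1).ne (hZpos P' hP').ne (main P' hP')
  · have hneg : ∫⁻ ω, ENNReal.ofReal (-c.stoppingCost ω) ∂P ≠ ∞ := hS.2.2.neg.lintegral_lt_top.ne
    have hneg' : ∫⁻ ω, ENNReal.ofReal (-c.stoppingCost ω) ∂P' ≠ ∞ :=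
      hP'.2.2.neg.lintegral_lt_top.ne
    have h := ENNReal.toReal_mono
      (ENNReal.add_ne_top.2 ⟨(hZpos P' hP'.1).ne, hneg⟩) (main P' hP'.1)
    rw [ENNReal.toReal_add (hZpos P hP.1).ne hneg',
      ENNReal.toReal_add (hZpos P' hP'.1).ne hneg] at h
    rw [CostIngredients.K, CostIngredients.K,
      integral_eq_lintegral_pos_part_sub_lintegral_neg_part hS.2.2,
      integral_eq_lintegral_pos_part_sub_lintegral_neg_part hP'.2.2]
    linarith
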